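/- Fix a countable first-order language $L$ and assume that there is an (uncountable, strongly) inaccessible cardinal. A \emph{map} $f:M\to N$ between $L$-structures is a partial injective function together with its domain $M$ and co-domain $N$; it is a \emph{partial embedding} (resp. \emph{elementary map}) if it preserves and reflects all quantifier-free formulas (resp. all formulas) on tuples from its domain of definition. An \emph{inductive amalgamation class} $\mathcal K$ is a category whose objects (\emph{models}) are infinite $L$-structures, whose morphisms are partial embeddings between models, composed as partial maps, and such that: (K0) models are closed under elementary equivalence; (K1) elementary maps between models are morphisms; (K2) the inverse partial map of a morphism is a morphism; (R) every restriction of a morphism is a morphism; (Ap) for every morphism $f:M\to N$ there are a model $N'$ with $N\le N'$ and a total morphism $h:M\to N'$ with $f\subseteq h$; (In) the union $M$ of a non-empty well-ordered chain of models $M_i$, with $M_i\le M_j$ for $i<j$, is a model, and $M_i\le M$ for all $i$. Here $M\le N$ means that $M\subseteq N$ is a substructure and the inclusion $M\to N$ is a morphism. A model $U$ is \emph{rich} if every morphism $f:M\to U$ with $|f|<|M|\le|U|$ extends to a total morphism $M\to U$. Let $T_{\rm rich}$ be the set of sentences that are true in all rich models. The class $\mathcal K$ is \emph{full} if for every model $M$: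 if each sentence true in $M$ is true in some rich model, then some rich model satisfies $\mathrm{Th}(M)$. A structure $M$ is \emph{saturated} if every finitely satisfiable set of formulas in finitely many variables over fewer than $|M|$ parameters from $M$ is realized in $M$. Assume condition (#): for all models $M,N$ of $\mathcal K$ with $M,N\models T_{\rm rich}$, $M\subseteq N\Leftrightarrow M\le N$. Then the following are equivalent: 1. $T_{\rm rich}$ is model-complete with respect to $\mathcal K$, that is, for all models $M,N$ of $\mathcal K$ with $M,N\models T_{\rm rich}$, $M\subseteq N\Leftrightarrow M\preceq N$; 2. all rich models are saturated and $\mathcal K$ is full. Moreover, if $T_{\rm rich}$ is model-complete in the usual sense (that is, $M\subseteq N\Leftrightarrow M\preceq N$ for all $L$-structures $M,N\models T_{\rm rich}$), then 2 holds; and if every $L$-structure that satisfies $T_{\rm rich}$ is a model of $\mathcal K$ (for instance, if $\mathcal K$ is the class of models of a first-order theory), then $T_{\rm rich}$ is model-complete in the usual sense if and only if 2 holds. -/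

import Mathlib

open FirstOrder FirstOrder.Language Cardinal

universe u

noncomputable section

namespace RichModels

variable {L : FirstOrder.Language.{0, 0}}

/-! Maps `f : M → N` between structures are partial maps. All of them are injective here, so they are
elements of `M ≃. N` (`PEquiv M N`): `b ∈ f a` means that `f` is defined at `a` with value `b`,
`f.symm` is the inverse map, `f.trans g` the composition "first `f`, then `g`",
and `f ≤ h` is inclusion of graphs. -/

/-- The map `f` is defined on its whole domain. -/
def IsTotal {M N : Type u} (f : M ≃. N) : Prop :=
  ∀ a : M, ∃ b : N, b ∈ f a

/-- The cardinality of the partial map `f`, that is, of its domain of definition. -/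
def mapCard {M N : Type u} (f : M ≃. N) : Cardinal.{u} :=
  #{a : M // ∃ b : N, b ∈ f a}

variable (L) in
/-- Partial embeddings preserve and reflect all quantifier-free formulas. -/
def IsPartialEmbedding {M N : Type u} [L.Structure M] [L.Structure N] (f : M ≃. N) : Prop :=
  ∀ (n : ℕ) (φ : L.Formula (Fin n)), φ.IsQF → ∀ (a : Fin n → M) (b : Fin n → N),
    (∀ i, b i ∈ f (a i)) → (φ.Realize a ↔ φ.Realize b)

variable (L) in
/-- Elementary maps preserve and reflect all formulas. -/
def IsElementaryMap {M N : Type u} [L.Structure M] [L.Structure N] (f : M ≃. N) : Prop :=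
  ∀ (n : ℕ) (φ : L.Formula (Fin n)) (a : Fin n → M) (b : Fin n → N),
    (∀ i, b i ∈ f (a i)) → (φ.Realize a ↔ φ.Realize b)

/-- An embedding of structures regarded as a (total) map. -/
def embMap {M N : Type u} [L.Structure M] [L.Structure N] (g : M ↪[L] N) : M ≃. N where
  toFun a := some (g a)
  invFun := Function.partialInv g
  inv a b := by
    have h : Function.partialInv g b = some a ↔ g a = b := g.injective.isPartialInv a b
    simp only [Option.some.injEq]
    exact h

variable (L) in
/-- An inductive amalgamation class of `L`-structures. -/
structure InductiveAmalgamationClass where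
  /-- The objects of the class, called models. -/
  IsModel : ∀ (M : Type u) [L.Structure M], Prop
  /-- The morphisms of the class. -/
  IsMor : ∀ {M N : Type u} [L.Structure M] [L.Structure N], (M ≃. N) → Prop
  /-- Models are infinite. -/
  infinite : ∀ {M : Type u} [L.Structure M], IsModel M → Infinite M
  /-- Domain and co-domain of a morphism are models. -/
  isModel_of_mor : ∀ {M N : Type u} [L.Structure M] [L.Structure N] {f : M ≃. N},
    IsMor f → IsModel M ∧ IsModel N
  /-- Morphisms are partial embeddings. -/
  partialEmbedding : ∀ {M N : Type u} [L.Structure M] [L.Structure N] {f : M ≃. N},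
    IsMor f → IsPartialEmbedding L f
  /-- Identities are morphisms. -/
  id_mor : ∀ {M : Type u} [L.Structure M], IsModel M → IsMor (PEquiv.refl M)
  /-- Morphisms are closed under composition. -/
  comp_mor : ∀ {M N P : Type u} [L.Structure M] [L.Structure N] [L.Structure P]
    {f : M ≃. N} {g : N ≃. P}, IsMor f → IsMor g → IsMor (f.trans g)
  /-- (K0) Models are closed under elementary equivalence. -/
  k0 : ∀ {M N : Type u} [L.Structure M] [L.Structure N], IsModel M → (M ≅[L] N) → IsModel N
  /-- (K1) Elementary maps between models are morphisms. -/
  k1 : ∀ {M N : Type u} [L.Structure M] [L.Structure N] {f : M ≃. N},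
    IsModel M → IsModel N → IsElementaryMap L f → IsMor f
  /-- (K2) The inverse of a morphism is a morphism. -/
  k2 : ∀ {M N : Type u} [L.Structure M] [L.Structure N] {f : M ≃. N}, IsMor f → IsMor f.symm
  /-- (R) Restrictions of morphisms are morphisms. -/
  restr : ∀ {M N : Type u} [L.Structure M] [L.Structure N] {f h : M ≃. N},
    IsMor h → f ≤ h → IsMor f
  /-- (Ap) Every morphism `f : M → N` extends to a strong embedding `h : M → N'`, where `N` is a
  strong submodel of `N'` (via the strong embedding `g`). -/
  ap : ∀ {M N : Type u} [L.Structure M] [L.Structure N] {f : M ≃. N}, IsMor f →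
    ∃ (N' : Type u) (_ : L.Structure N') (g : N ≃. N') (h : M ≃. N'),
      IsMor g ∧ IsTotal g ∧ IsMor h ∧ IsTotal h ∧ f.trans g ≤ h
  /-- (In) If `M` is the union of a chain of models (a nonempty well-ordered family `S` of
  substructures, each a strong submodel of all later ones), then `M` is a model and every member of
  the chain is a strong submodel of `M`. -/
  ind : ∀ {M : Type u} [L.Structure M] {ι : Type u} [LinearOrder ι] [WellFoundedLT ι] [Nonempty ι]
    (S : ι → L.Substructure M) (hS : Monotone S),
    (∀ i, IsModel (S i)) →
    (∀ i j (hij : i < j), IsMor (embMap (Substructure.inclusion (hS hij.le)))) →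
    (∀ x : M, ∃ i, x ∈ S i) →
    IsModel M ∧ ∀ i, IsMor (embMap (S i).subtype)

namespace InductiveAmalgamationClass

variable (K : InductiveAmalgamationClass.{u} L)

/-- The substructure `S` of `N` is a strong submodel of `N`, written `S ≤ N`. -/
def StrongSubmodel {N : Type u} [L.Structure N] (S : L.Substructure N) : Prop :=
  K.IsMor (embMap S.subtype)

/-- `U` is a `κ`-rich model. -/
def IsRichAt (κ : Cardinal.{u}) (U : Type u) [L.Structure U] : Prop :=
  K.IsModel U ∧ ∀ (M : Type u) [L.Structure M] (f : M ≃. U), K.IsMor f →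
    mapCard f < #M → #M ≤ κ → ∃ h : M ≃. U, K.IsMor h ∧ IsTotal h ∧ f ≤ h

/-- `U` is a rich model. -/
def IsRich (U : Type u) [L.Structure U] : Prop :=
  K.IsRichAt #U U

/-- The theory of the rich models. -/
def richTheory : L.Theory :=
  {φ | ∀ (U : Type u) [L.Structure U], K.IsRich U → U ⊨ φ}

/-- The class is full. -/
def IsFull : Prop :=
  ∀ (M : Type u) [L.Structure M], K.IsModel M →
    (∀ φ : L.Sentence, M ⊨ φ → ∃ (U : Type u) (_ : L.Structure U), K.IsRich U ∧ U ⊨ φ) →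
    ∃ (U : Type u) (_ : L.Structure U), K.IsRich U ∧ U ⊨ L.completeTheory M

/-- Condition `#`: between models of the class that satisfy the theory of the rich models,
substructures are the same as strong submodels. -/
def SubstructuresStrong : Prop :=
  ∀ (N : Type u) [L.Structure N] (S : L.Substructure N), K.IsModel S → K.IsModel N →
    S ⊨ K.richTheory → N ⊨ K.richTheory → K.StrongSubmodel S

/-- The theory `T` is model-complete with respect to the models of the class: between models of the
class that satisfy `T`, substructures are the same as elementary substructures. -/
def ModelCompleteIn (T : L.Theory) : Prop :=
  ∀ (N : Type u) [L.Structure N] (S : L.Substructure N), K.IsModel S → K.IsModel N →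
    S ⊨ T → N ⊨ T → S.IsElementary

end InductiveAmalgamationClass

/-- The theory `T` is model-complete (among all structures): between structures that satisfy `T`,
substructures are the same as elementary substructures. -/
def ModelComplete (T : L.Theory) : Prop :=
  ∀ (N : Type u) [L.Structure N] (S : L.Substructure N), S ⊨ T → N ⊨ T → S.IsElementary

variable (L) in
/-- `M` is `κ`-saturated: every type in finitely many variables over fewer than `κ` parameters, that
is, every finitely satisfiable set of formulas, is realized in `M`. -/
def IsSaturatedAt (κ : Cardinal.{u}) (M : Type u) [L.Structure M] : Prop :=
  ∀ (A : Set M), #A < κ → ∀ (n : ℕ) (p : Set (L.Formula (A ⊕ Fin n))),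
    (∀ p₀ : Finset (L.Formula (A ⊕ Fin n)), (p₀ : Set _) ⊆ p →
      ∃ x : Fin n → M, ∀ φ ∈ p₀, φ.Realize (Sum.elim (fun a : A => (a : M)) x)) →
    ∃ x : Fin n → M, ∀ φ ∈ p, φ.Realize (Sum.elim (fun a : A => (a : M)) x)

variable (L) in
/-- `M` is saturated. -/
def IsSaturated (M : Type u) [L.Structure M] : Prop :=
  IsSaturatedAt L #M M

/-- All rich models of the class are saturated. -/
def InductiveAmalgamationClass.RichSaturated (K : InductiveAmalgamationClass.{u} L) : Prop :=
  ∀ (U : Type u) [L.Structure U], K.IsRich U → IsSaturated L U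

end RichModels

end

noncomputable section

namespace RichModels

variable {L : FirstOrder.Language.{0, 0}}

/-! ### Partial injections given by their graphs, and their cardinality -/

section PartialMaps

variable {M N P : Type u}

/-! The engine is back-and-forth: a morphism between rich models can be restricted to a finite one
and then extended by any point on either side, so induction on formulas shows that morphisms between
rich models are elementary (`realize_iff_of_isMor`).

From 2 to 1, let `S ⊆ N` satisfy `T_rich` and let `a` be a tuple in `S`. Fullness gives rich `U ≡ S`
and `V ≡ N`; saturation realizes the type of `a` in `S` by some `x` in `U`, and its type in `N` by
some `y` in `V`. The composite `x ↦ a ↦ a ↦ y` is a morphism, since its outer parts are elementary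
and its middle is a restriction of a strong inclusion by (#). Hence it is elementary, and the two
types of `a` agree.

From 1 to 2, a type over a small set `A ⊆ U` is realized in an elementary extension `N` of size
`|U|`. Richness maps `N` back into `U` over `A`; model-completeness makes this map elementary, so it
carries the realization into `U`. For fullness, `M` is replaced by an elementarily equivalent model
of inaccessible size `κ`, which embeds in a rich model (`exists_isRich`), elementarily by 1.

Rich models come from a chain of length `κ` in which each stage extends all morphisms from models of
size below `κ` into the earlier ones. Inaccessibility bounds the number of such morphisms by `κ` and
makes each of them factor through an earlier stage. Source models of size exactly `κ` are embedded
in a model of the same kind, where a transfinite extension of elementary maps finishes. -/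

open scoped Classical in
theorem dite_choose_eq_some_iff {α : Type*} {p : α → Prop} (hp : ∀ a b, p a → p b → a = b) (a : α) :
    (if h : ∃ a, p a then some h.choose else none) = some a ↔ p a := by
  split_ifs with h
  · rw [Option.some_inj]
    exact ⟨fun e => e ▸ h.choose_spec, fun e => hp _ _ h.choose_spec e⟩
  · simp only [false_iff]
    exact fun h' => h ⟨a, h'⟩

open scoped Classical in
/-- The partial injection with a given graph. -/
def ofRel (r : M → N → Prop) (h₁ : ∀ a b b', r a b → r a b' → b = b')
    (h₂ : ∀ a a' b, r a b → r a' b → a = a') : M ≃. N where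
  toFun a := if h : ∃ b, r a b then some h.choose else none
  invFun b := if h : ∃ a, r a b then some h.choose else none
  inv a b := (dite_choose_eq_some_iff (fun _ _ => h₂ _ _ _) a).trans
    (dite_choose_eq_some_iff (fun _ _ => h₁ _ _ _) b).symm

theorem mem_ofRel {r : M → N → Prop} {h₁ h₂} {a : M} {b : N} :
    b ∈ ofRel r h₁ h₂ a ↔ r a b :=
  dite_choose_eq_some_iff (fun _ _ => h₁ _ _ _) b

/-- An injective function regarded as a total map. -/
def ofInj (g : M → N) (hg : Function.Injective g) : M ≃. N :=
  ofRel (fun a b => g a = b) (fun _ _ _ h h' => h.symm.trans h') (fun _ _ _ h h' => hg (h.trans h'.symm))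

theorem mem_ofInj {g : M → N} {hg : Function.Injective g} {a : M} {b : N} :
    b ∈ ofInj g hg a ↔ g a = b := mem_ofRel

theorem isTotal_ofInj (g : M → N) (hg : Function.Injective g) : IsTotal (ofInj g hg) :=
  fun a => ⟨g a, mem_ofInj.2 rfl⟩

theorem pequiv_ext_mem {f g : M ≃. N} (h : ∀ a b, b ∈ f a ↔ b ∈ g a) : f = g :=
  le_antisymm (PEquiv.le_def.2 fun a b => (h a b).1) (PEquiv.le_def.2 fun a b => (h a b).2)

theorem mem_unique {f : M ≃. N} {a : M} {b b' : N} (h : b ∈ f a) (h' : b' ∈ f a) : b = b' :=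
  Option.mem_unique h h'

theorem IsTotal.trans {f : M ≃. N} {g : N ≃. P} (hf : IsTotal f) (hg : IsTotal g) :
    IsTotal (f.trans g) := fun a => by
  obtain ⟨b, hb⟩ := hf a
  obtain ⟨c, hc⟩ := hg b
  exact ⟨c, (PEquiv.mem_trans ..).2 ⟨b, hb, hc⟩⟩

theorem IsTotal.exists_eq_ofInj {f : M ≃. N} (hf : IsTotal f) :
    ∃ (g : M → N) (hg : Function.Injective g), f = ofInj g hg := by
  choose g hg using hf
  have hi : Function.Injective g := fun a a' h => f.inj (hg a) (h ▸ hg a')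
  refine ⟨g, hi, pequiv_ext_mem fun a b => ?_⟩
  rw [mem_ofInj]
  exact ⟨fun h => mem_unique (hg a) h, fun h => h ▸ hg a⟩

theorem mapCard_le_of_forall_mem {f : M ≃. N} {s : Set M} (h : ∀ a b, b ∈ f a → a ∈ s) :
    mapCard f ≤ #s :=
  mk_le_of_injective (f := fun x : {a : M // ∃ b : N, b ∈ f a} =>
    (⟨x.1, h _ _ x.2.choose_spec⟩ : s)) fun _ _ hxy => Subtype.ext (Subtype.mk.inj hxy)

/-- Composing on the left does not increase the cardinality of a map. -/
theorem mapCard_trans_le (f : M ≃. N) (g : N ≃. P) : mapCard (f.trans g) ≤ mapCard g := by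
  have key : ∀ x : {a : M // ∃ c : P, c ∈ f.trans g a},
      ∃ y : {b : N // ∃ c : P, c ∈ g b}, y.1 ∈ f x.1 := fun x => by
    obtain ⟨a, c, hc⟩ := x
    obtain ⟨b, hb, hc⟩ := (PEquiv.mem_trans ..).1 hc
    exact ⟨⟨b, c, hc⟩, hb⟩
  choose k hk using key
  exact mk_le_of_injective (f := k) fun x y hxy =>
    Subtype.ext (f.inj (hk x) (hxy ▸ hk y))

/-- The map sending one tuple to another one with the same equalities between entries. -/
def tupleMap {ι : Type*} (x : ι → M) (y : ι → N) (h : ∀ i j, x i = x j ↔ y i = y j) : M ≃. N :=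
  ofRel (fun a b => ∃ i, x i = a ∧ y i = b)
    (by rintro a b b' ⟨i, hi, rfl⟩ ⟨j, hj, rfl⟩; exact (h i j).1 (hi.trans hj.symm))
    (by rintro a b b' ⟨i, rfl, hi⟩ ⟨j, rfl, hj⟩; exact (h i j).2 (hi.trans hj.symm))

theorem mem_tupleMap {ι : Type*} {x : ι → M} {y : ι → N} {h} {a : M} {b : N} :
    b ∈ tupleMap x y h a ↔ ∃ i, x i = a ∧ y i = b := mem_ofRel

end PartialMaps

/-! ### Elementary maps, embeddings and Löwenheim–Skolem -/

section Structures

variable {M N P : Type u} [L.Structure M] [L.Structure N] [L.Structure P]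

theorem embMap_eq_ofInj (g : M ↪[L] N) : embMap g = ofInj g g.injective :=
  pequiv_ext_mem fun a b => by
    rw [mem_ofInj]
    exact Option.some_inj

theorem mem_embMap {g : M ↪[L] N} {a : M} {b : N} : b ∈ embMap g a ↔ g a = b := by
  rw [embMap_eq_ofInj, mem_ofInj]

theorem isElementaryMap_ofInj (e : M ↪ₑ[L] N) : IsElementaryMap L (ofInj e e.injective) := by
  intro n φ a b h
  have : b = e ∘ a := funext fun i => (mem_ofInj.1 (h i)).symm
  rw [this, e.map_formula]

theorem IsElementaryMap.mono {f g : M ≃. N} (hg : IsElementaryMap L g) (h : f ≤ g) :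
    IsElementaryMap L f :=
  fun n φ a b hab => hg n φ a b fun i => h _ _ (hab i)

theorem IsElementaryMap.symm {f : M ≃. N} (hf : IsElementaryMap L f) :
    IsElementaryMap L f.symm :=
  fun n φ a b hab => (hf n φ b a fun i => f.mem_iff_mem.1 (hab i)).symm

theorem isElementaryMap_tupleMap {n : ℕ} {x : Fin n → M} {y : Fin n → N}
    (hxy : ∀ φ : L.Formula (Fin n), φ.Realize x ↔ φ.Realize y) (h) :
    IsElementaryMap L (tupleMap x y h) := by
  intro m φ a b hab
  choose k hk using fun i => mem_tupleMap.1 (hab i)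
  have ha : a = x ∘ k := funext fun i => (hk i).1.symm
  have hb : b = y ∘ k := funext fun i => (hk i).2.symm
  rw [ha, hb, ← Formula.realize_relabel, ← Formula.realize_relabel]
  exact hxy _

theorem eq_iff_of_formula_iff {ι : Type*} {x : ι → M} {y : ι → N}
    (hxy : ∀ φ : L.Formula ι, φ.Realize x ↔ φ.Realize y) (i j : ι) : x i = x j ↔ y i = y j := by
  simpa using hxy (Term.equal (Term.var i) (Term.var j))

/-- A total partial embedding is an embedding. -/
theorem IsPartialEmbedding.exists_embedding {f : M ≃. N} (hf : IsPartialEmbedding L f)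
    (ht : IsTotal f) : ∃ g : M ↪[L] N, f = embMap g := by
  obtain ⟨g, hg, rfl⟩ := ht.exists_eq_ofInj
  refine ⟨⟨⟨g, hg⟩, fun {n} F x => ?_, fun {n} R x => ?_⟩, ?_⟩
  -- The formula `F(x₀, …, xₙ₋₁) = xₙ` expresses the graph of `F`; the value is appended as the last
  -- entry of the tuple.
  · have := hf (n + 1) (Term.equal (Term.func F fun i => Term.var i.castSucc)
      (Term.var (Fin.last n))) (BoundedFormula.IsAtomic.equal _ _).isQF
      (Fin.snoc x (Structure.funMap F x)) (Fin.snoc (g ∘ x) (g (Structure.funMap F x)))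
      (fun i => mem_ofInj.2 (by refine Fin.lastCases ?_ (fun j => ?_) i <;> simp))
    simp only [Formula.realize_equal, Term.realize_func, Term.realize_var, Fin.snoc_castSucc,
      Fin.snoc_last, true_iff] at this
    exact this.symm
  · have := hf n (R.formula fun i => Term.var i) (BoundedFormula.IsAtomic.rel _ _).isQF
      x (g ∘ x) (fun i => mem_ofInj.2 rfl)
    simp only [Formula.realize_rel, Term.realize_var] at this
    exact this.symm
  · exact pequiv_ext_mem fun a b => by rw [mem_ofInj, mem_embMap]; rfl

/-- **Downward Löwenheim–Skolem** for countable languages. -/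
theorem exists_elementarySubstructure_card (hL : L.card ≤ ℵ₀) (s : Set M) (κ : Cardinal.{u})
    (h1 : ℵ₀ ≤ κ) (h2 : #s ≤ κ) (h4 : κ ≤ #M) :
    ∃ S : L.ElementarySubstructure M, s ⊆ S ∧ #S = κ := by
  obtain ⟨S, hS, hc⟩ := exists_elementarySubstructure_card_eq L s κ h1 (lift_le.2 h2)
    (by
      refine (lift_le.2 hL).trans ?_
      simpa using h1) (lift_le.2 h4)
  exact ⟨S, hS, lift_inj.1 hc⟩

end Structures

/-! ### Back-and-forth between rich models -/

namespace InductiveAmalgamationClass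

variable {K : InductiveAmalgamationClass.{u} L}
variable {M N P : Type u} [L.Structure M] [L.Structure N] [L.Structure P]

theorem isModel_of_elementaryEmbedding (hN : K.IsModel N) (e : M ↪ₑ[L] N) : K.IsModel M :=
  K.k0 hN e.elementarilyEquivalent.symm

theorem isMor_ofInj_elementaryEmbedding (hN : K.IsModel N) (e : M ↪ₑ[L] N) :
    K.IsMor (ofInj e e.injective) :=
  K.k1 (isModel_of_elementaryEmbedding hN e) hN (isElementaryMap_ofInj e)

theorem isMor_ofInj_equiv (hN : K.IsModel N) (e : M ≃[L] N) : K.IsMor (ofInj e e.injective) :=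
  isMor_ofInj_elementaryEmbedding hN e.toElementaryEmbedding

/-- If `V` is `κ`-rich, a small morphism into `V` can be extended to any further point. -/
theorem IsRichAt.exists_extend (hL : L.card ≤ ℵ₀) {κ μ : Cardinal.{u}} {U V : Type u}
    [L.Structure U] [L.Structure V] (hV : K.IsRichAt κ V) {f : U ≃. V} (hf : K.IsMor f)
    (h₀ : ℵ₀ ≤ μ) (hμκ : μ ≤ κ) (hμU : μ ≤ #U) (hfμ : mapCard f < μ) (a : U) :
    ∃ g : U ≃. V, K.IsMor g ∧ f ≤ g ∧ ∃ b, b ∈ g a := by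
  have hU := (K.isModel_of_mor hf).1
  -- Richness only extends maps to whole models, so the new point is first enclosed, with the domain
  -- of `f`, in an elementary submodel of size exactly `μ`: larger than `f`, yet at most `κ`.
  obtain ⟨A, hA, hAc⟩ := exists_elementarySubstructure_card hL
    (insert a {a | ∃ b, b ∈ f a}) μ h₀
    ((mk_insert_le).trans (add_le_of_le h₀ hfμ.le (one_le_aleph0.trans h₀))) hμU
  have hi := isMor_ofInj_elementaryEmbedding hU A.subtype
  obtain ⟨h, hm, ht, hle⟩ := hV.2 A ((ofInj A.subtype A.subtype.injective).trans f)
    (K.comp_mor hi hf) (by rw [hAc]; exact (mapCard_trans_le _ _).trans_lt hfμ) (by rw [hAc]; exact hμκ)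
  refine ⟨(ofInj A.subtype A.subtype.injective).symm.trans h, K.comp_mor (K.k2 hi) hm,
    PEquiv.le_def.2 fun x y hxy => ?_, ?_⟩
  · have hx : x ∈ A := hA (Or.inr ⟨y, hxy⟩)
    refine (PEquiv.mem_trans ..).2 ⟨⟨x, hx⟩, (PEquiv.mem_iff_mem _).2 (mem_ofInj.2 rfl), ?_⟩
    exact hle _ _ ((PEquiv.mem_trans ..).2 ⟨x, mem_ofInj.2 rfl, hxy⟩)
  · have ha : a ∈ A := hA (Or.inl rfl)
    obtain ⟨b, hb⟩ := ht ⟨a, ha⟩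
    exact ⟨b, (PEquiv.mem_trans ..).2 ⟨⟨a, ha⟩, (PEquiv.mem_iff_mem _).2 (mem_ofInj.2 rfl), hb⟩⟩

end InductiveAmalgamationClass

/-- The restriction of a map to a set. -/
def restrictMap {M N : Type u} (f : M ≃. N) (s : Set M) : M ≃. N :=
  ofRel (fun a b => a ∈ s ∧ b ∈ f a) (fun _ _ _ h h' => mem_unique h.2 h'.2)
    (fun _ _ _ h h' => f.inj h.2 h'.2)

theorem mem_restrictMap {M N : Type u} {f : M ≃. N} {s : Set M} {a : M} {b : N} :
    b ∈ restrictMap f s a ↔ a ∈ s ∧ b ∈ f a := mem_ofRel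

theorem restrictMap_le {M N : Type u} (f : M ≃. N) (s : Set M) : restrictMap f s ≤ f :=
  PEquiv.le_def.2 fun _ _ h => (mem_restrictMap.1 h).2

theorem mapCard_restrictMap_le {M N : Type u} (f : M ≃. N) (s : Set M) :
    mapCard (restrictMap f s) ≤ #s :=
  mapCard_le_of_forall_mem fun _ _ h => (mem_restrictMap.1 h).1

theorem mapCard_symm {M N : Type u} (f : M ≃. N) : mapCard f.symm = mapCard f := by
  have key : ∀ {M N : Type u} (f : M ≃. N), mapCard f.symm ≤ mapCard f := fun {M N} f => by
    have h : ∀ x : {b : N // ∃ a : M, a ∈ f.symm b},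
        ∃ y : {a : M // ∃ b : N, b ∈ f a}, x.1 ∈ f y.1 := fun ⟨b, a, h⟩ =>
      ⟨⟨a, b, f.mem_iff_mem.1 h⟩, f.mem_iff_mem.1 h⟩
    choose k hk using h
    exact mk_le_of_injective (f := k) fun x y hxy =>
      Subtype.ext (mem_unique (hk x) (hxy ▸ hk y))
  exact le_antisymm (key f) (key f.symm)

namespace InductiveAmalgamationClass

variable {K : InductiveAmalgamationClass.{u} L}

/-- One implication suffices because `U`, `V` and `f` are quantified inside the induction: the
converse, needed for the premise of an implication, comes from the inverse morphism. -/
theorem realize_iff_of_isMor (hL : L.card ≤ ℵ₀) {α : Type} [Finite α] {n : ℕ}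
    (φ : L.BoundedFormula α n) : ∀ {U V : Type u} [L.Structure U] [L.Structure V],
    K.IsRichAt ℵ₀ U → K.IsRichAt ℵ₀ V → ∀ {f : U ≃. V}, K.IsMor f →
    ∀ (v : α → U) (xs : Fin n → U) (v' : α → V) (xs' : Fin n → V),
    (∀ i, v' i ∈ f (v i)) → (∀ i, xs' i ∈ f (xs i)) →
    φ.Realize v xs → φ.Realize v' xs' := by
  induction φ with
  | falsum => exact fun _ _ _ _ _ _ _ _ _ _ h => h
  | @equal n t₁ t₂ =>
    intro U V _ _ hU hV f hf v xs v' xs' hv hxs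
    obtain ⟨m, ⟨e⟩⟩ := Finite.exists_equiv_fin (α ⊕ Fin n)
    have := K.partialEmbedding hf m (Term.equal (t₁.relabel e) (t₂.relabel e))
      (BoundedFormula.IsAtomic.equal _ _).isQF (Sum.elim v xs ∘ e.symm) (Sum.elim v' xs' ∘ e.symm)
      (fun i => by rcases h : e.symm i with j | j <;> simp [h, hv, hxs])
    simp only [Formula.realize_equal, Term.realize_relabel, Function.comp_assoc,
      _root_.Equiv.symm_comp_self, Function.comp_id] at this
    exact this.1
  | @rel n l R ts =>
    intro U V _ _ hU hV f hf v xs v' xs' hv hxs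
    obtain ⟨m, ⟨e⟩⟩ := Finite.exists_equiv_fin (α ⊕ Fin n)
    have := K.partialEmbedding hf m (R.formula fun i => (ts i).relabel e)
      (BoundedFormula.IsAtomic.rel _ _).isQF (Sum.elim v xs ∘ e.symm) (Sum.elim v' xs' ∘ e.symm)
      (fun i => by rcases h : e.symm i with j | j <;> simp [h, hv, hxs])
    simp only [Formula.realize_rel, Term.realize_relabel, Function.comp_assoc,
      _root_.Equiv.symm_comp_self, Function.comp_id] at this
    exact this.1
  | imp φ ψ ihφ ihψ =>
    intro U V _ _ hU hV f hf v xs v' xs' hv hxs h h'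
    refine ihψ hU hV hf v xs v' xs' hv hxs (h ?_)
    exact ihφ hV hU (K.k2 hf) v' xs' v xs (fun i => f.mem_iff_mem.2 (hv i))
      (fun i => f.mem_iff_mem.2 (hxs i)) h'
  | @all n φ ih =>
    intro U V _ _ hU hV f hf v xs v' xs' hv hxs h b
    have := K.infinite hV.1
    have hfin : (Set.range v ∪ Set.range xs).Finite :=
      (Set.finite_range v).union (Set.finite_range xs)
    -- Only the finitely many parameters matter. The restricted map is finite, so its inverse
    -- extends to the given `b` in `V`, yielding a witness `a` in `U`.
    have hg := K.restr hf (restrictMap_le f (Set.range v ∪ Set.range xs))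
    obtain ⟨g, hgm, hle, a, hab⟩ := hU.exists_extend hL (K.k2 hg) le_rfl le_rfl
      (infinite_iff.1 this) (by
        rw [mapCard_symm]
        exact (mapCard_restrictMap_le _ _).trans_lt (lt_aleph0_iff_set_finite.2 hfin)) b
    have hmem : ∀ x y, x ∈ Set.range v ∪ Set.range xs → y ∈ f x → y ∈ g.symm x := fun x y hx hy =>
      g.mem_iff_mem.2 (hle _ _ ((PEquiv.mem_iff_mem _).2 (mem_restrictMap.2 ⟨hx, hy⟩)))
    refine ih hU hV (K.k2 hgm) v (Fin.snoc xs a) v' (Fin.snoc xs' b)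
      (fun i => hmem _ _ (Or.inl ⟨i, rfl⟩) (hv i)) (fun i => ?_) (h a)
    refine Fin.lastCases ?_ (fun j => ?_) i
    · simpa using g.mem_iff_mem.2 hab
    · simpa using hmem _ _ (Or.inr ⟨j, rfl⟩) (hxs j)

/-- Morphisms between `ℵ₀`-rich models are elementary. -/
theorem IsRichAt.isElementaryMap (hL : L.card ≤ ℵ₀) {U V : Type u} [L.Structure U] [L.Structure V]
    (hU : K.IsRichAt ℵ₀ U) (hV : K.IsRichAt ℵ₀ V) {f : U ≃. V} (hf : K.IsMor f) :
    IsElementaryMap L f := fun _ φ a b h =>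
  ⟨realize_iff_of_isMor hL φ hU hV hf a default b default h finZeroElim,
    realize_iff_of_isMor hL φ hV hU (K.k2 hf) b default a default
      (fun i => f.mem_iff_mem.2 (h i)) finZeroElim⟩

theorem IsRichAt.mono {κ μ : Cardinal.{u}} {U : Type u} [L.Structure U] (hU : K.IsRichAt κ U)
    (h : μ ≤ κ) : K.IsRichAt μ U :=
  ⟨hU.1, fun M _ f hf h1 h2 => hU.2 M f hf h1 (h2.trans h)⟩

theorem IsRich.isRichAt_aleph0 {U : Type u} [L.Structure U] (hU : K.IsRich U) :
    K.IsRichAt ℵ₀ U :=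
  have := K.infinite hU.1
  IsRichAt.mono hU (infinite_iff.1 this)

end InductiveAmalgamationClass

/-! ### Transfinite extension of elementary maps -/

/-- The union of a chain of elementary maps. -/
theorem exists_isElementaryMap_of_chain {M N : Type u} [L.Structure M] [L.Structure N]
    (c : Set (M ≃. N)) (hc : IsChain (· ≤ ·) c) (hne : c.Nonempty)
    (he : ∀ f ∈ c, IsElementaryMap L f) :
    ∃ g : M ≃. N, IsElementaryMap L g ∧ ∀ a b, b ∈ g a ↔ ∃ f ∈ c, b ∈ f a := by
  have key : ∀ f₁ ∈ c, ∀ f₂ ∈ c, ∃ f ∈ c, f₁ ≤ f ∧ f₂ ≤ f := fun f₁ h₁ f₂ h₂ =>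
    (hc.total h₁ h₂).elim (fun h => ⟨f₂, h₂, h, le_rfl⟩) (fun h => ⟨f₁, h₁, le_rfl, h⟩)
  let g : M ≃. N := ofRel (fun a b => ∃ f ∈ c, b ∈ f a)
    (fun a b b' ⟨f₁, h₁, hb⟩ ⟨f₂, h₂, hb'⟩ => by
      obtain ⟨f, -, hf₁, hf₂⟩ := key _ h₁ _ h₂
      exact mem_unique (hf₁ _ _ hb) (hf₂ _ _ hb'))
    (fun a a' b ⟨f₁, h₁, hb⟩ ⟨f₂, h₂, hb'⟩ => by
      obtain ⟨f, -, hf₁, hf₂⟩ := key _ h₁ _ h₂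
      exact f.inj (hf₁ _ _ hb) (hf₂ _ _ hb'))
  refine ⟨g, fun n φ a b h => ?_, fun a b => mem_ofRel⟩
  choose f hf hfm using fun i => mem_ofRel.1 (h i)
  obtain ⟨k, hk, hle⟩ : ∃ k ∈ c, ∀ i, f i ≤ k := by
    have : ∀ s : Finset (Fin n), ∃ k ∈ c, ∀ i ∈ s, f i ≤ k := fun s => by
      classical
      induction s using Finset.induction_on with
      | empty => exact ⟨hne.some, hne.some_mem, by simp⟩
      | insert i s _ ih =>
        obtain ⟨k, hk, hle⟩ := ih
        obtain ⟨l, hl, h₁, h₂⟩ := key _ hk _ (hf i)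
        refine ⟨l, hl, fun j hj => ?_⟩
        rcases Finset.mem_insert.1 hj with rfl | hj
        · exact h₂
        · exact (hle j hj).trans h₁
    obtain ⟨k, hk, h⟩ := this Finset.univ
    exact ⟨k, hk, fun i => h i (Finset.mem_univ i)⟩
  exact he k hk n φ a b fun i => hle i _ _ (hfm i)

namespace InductiveAmalgamationClass

variable {K : InductiveAmalgamationClass.{u} L}

/-- If small elementary maps into `U` can be extended to any further point, they can be extended to
total ones. -/
theorem exists_total_isElementaryMap {M U : Type u} [L.Structure M] [L.Structure U]
    {κ : Cardinal.{u}} (hκ : ℵ₀ ≤ κ) (hM : #M ≤ κ)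
    (hext : ∀ f : M ≃. U, IsElementaryMap L f → mapCard f < κ → ∀ a,
      ∃ g, IsElementaryMap L g ∧ f ≤ g ∧ ∃ b, b ∈ g a)
    {f : M ≃. U} (hf : IsElementaryMap L f) (hfκ : mapCard f < κ) :
    ∃ g, IsElementaryMap L g ∧ IsTotal g ∧ f ≤ g := by
  obtain ⟨r, hr, hord⟩ := exists_ord_eq M
  -- Outside the domain of `f`, points are added only in the order of a well-order of type `#M`.
  -- This keeps every non-total map in `D` smaller than `κ`, which bare Zorn maximality would not.
  let D : Set (M ≃. U) := {g | IsElementaryMap L g ∧ f ≤ g ∧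
    ∀ a, (∃ b, b ∈ g a) → (∃ b, b ∈ f a) ∨ ∀ a', r a' a → ∃ b, b ∈ g a'}
  obtain ⟨g, hfg, hg⟩ : ∃ g, f ≤ g ∧ Maximal (· ∈ D) g := by
    refine zorn_le_nonempty₀ D (fun c hc hch y hy => ?_) f ⟨hf, le_rfl, fun a h => Or.inl h⟩
    obtain ⟨g, hge, hgm⟩ := exists_isElementaryMap_of_chain c hch ⟨y, hy⟩ fun k hk => (hc hk).1
    have hle : ∀ k ∈ c, k ≤ g := fun k hk => PEquiv.le_def.2 fun a b h => (hgm a b).2 ⟨k, hk, h⟩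
    refine ⟨g, ⟨hge, (hc hy).2.1.trans (hle y hy), ?_⟩, hle⟩
    rintro a ⟨b, hb⟩
    obtain ⟨k, hk, hb⟩ := (hgm a b).1 hb
    refine ((hc hk).2.2 a ⟨b, hb⟩).imp_right fun h a' ha' => ?_
    obtain ⟨b', hb'⟩ := h a' ha'
    exact ⟨b', hle k hk _ _ hb'⟩
  refine ⟨g, hg.prop.1, ?_, hfg⟩
  by_contra hnt
  have hne : {a | ¬ ∃ b, b ∈ g a}.Nonempty := by
    simpa [IsTotal, Set.Nonempty] using hnt
  obtain ⟨a, ha, hmin⟩ := hr.wf.has_min _ hne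
  have hlow : ∀ a', r a' a → ∃ b, b ∈ g a' := fun a' h => by
    by_contra h'
    exact hmin a' h' h
  have hcard : mapCard g < κ := by
    have h1 : mapCard g ≤ #({a | ∃ b, b ∈ f a} ∪ {a' | r a' a} : Set M) := by
      refine mapCard_le_of_forall_mem fun x y hxy => ?_
      rcases hg.prop.2.2 x ⟨y, hxy⟩ with h | h
      · exact Or.inl h
      · refine Or.inr ?_
        rcases trichotomous_of r x a with h' | h' | h'
        · exact h'
        · exact (ha (h' ▸ ⟨y, hxy⟩)).elim
        · exact (ha (h a h')).elim
    refine h1.trans_lt ((mk_union_le _ _).trans_lt (add_lt_of_lt hκ hfκ ?_))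
    refine lt_of_lt_of_le ?_ hM
    exact card_typein_lt a hord
  obtain ⟨g', hge', hle, b, hb⟩ := hext g hg.prop.1 hcard a
  -- The extension `g'` may be defined at unwanted points; keeping only `a` beyond the domain of `g`
  -- stays in `D`.
  let k := restrictMap g' {x | (∃ b, b ∈ g x) ∨ x = a}
  have hgk : g ≤ k := PEquiv.le_def.2 fun x y h =>
    mem_restrictMap.2 ⟨Or.inl ⟨y, h⟩, hle _ _ h⟩
  have hk : k ∈ D := by
    refine ⟨hge'.mono (restrictMap_le _ _), hfg.trans hgk, ?_⟩
    rintro x ⟨y, hy⟩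
    rcases (mem_restrictMap.1 hy).1 with h | rfl
    · refine (hg.prop.2.2 x h).imp_right fun h' x' hx' => ?_
      obtain ⟨y', hy'⟩ := h' x' hx'
      exact ⟨y', hgk _ _ hy'⟩
    · refine Or.inr fun x' hx' => ?_
      obtain ⟨y', hy'⟩ := hlow x' hx'
      exact ⟨y', hgk _ _ hy'⟩
  exact ha ⟨b, hg.le_of_ge hk hgk _ _ (mem_restrictMap.2 ⟨Or.inr rfl, hb⟩)⟩

end InductiveAmalgamationClass

/-! ### Transfinite chains of models inside a fixed set -/

/-- In a preorder where chains have upper bounds, one-step extensions can be iterated along any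
well-order. -/
theorem exists_chain {P W : Type*} [Preorder P] [LinearOrder W] [WellFoundedLT W] (p₀ : P)
    (hub : ∀ (w : W) (g : Set.Iio w → P), Monotone g → (∀ i, p₀ ≤ g i) →
      ∃ q, p₀ ≤ q ∧ ∀ i, g i ≤ q)
    (R : W → P → P → Prop) (step : ∀ w q, p₀ ≤ q → ∃ q', q ≤ q' ∧ R w q q') :
    ∃ g : W → P, Monotone g ∧ (∀ w, p₀ ≤ g w) ∧
      ∀ w, ∃ q, p₀ ≤ q ∧ (∀ v < w, g v ≤ q) ∧ q ≤ g w ∧ R w q (g w) := by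
  -- The value `p₀` is a dummy for families that are not monotone above `p₀`; those never arise in
  -- the recursion.
  have hnext : ∀ (w : W) (g : Set.Iio w → P), ∃ q', (Monotone g ∧ ∀ i, p₀ ≤ g i) →
      ∃ q, p₀ ≤ q ∧ (∀ i, g i ≤ q) ∧ q ≤ q' ∧ R w q q' := fun w g => by
    by_cases h : Monotone g ∧ ∀ i, p₀ ≤ g i
    · obtain ⟨q, hq, hi⟩ := hub w g h.1 h.2
      obtain ⟨q', hq', hR⟩ := step w q hq
      exact ⟨q', fun _ => ⟨q, hq, hi, hq', hR⟩⟩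
    · exact ⟨p₀, fun h' => (h h').elim⟩
  choose next hnext using hnext
  let g : W → P := (wellFounded_lt (α := W)).fix fun w ih => next w fun v => ih v.1 v.2
  have hg : ∀ w, g w = next w fun v => g v.1 := fun w => WellFounded.fix_eq ..
  have key : ∀ w, ∃ q, p₀ ≤ q ∧ (∀ v < w, g v ≤ q) ∧ q ≤ g w ∧ R w q (g w) := fun w => by
    induction w using (wellFounded_lt (α := W)).induction with
    | _ w ih =>
      obtain ⟨q, hq, hi, hle, hR⟩ := hnext w (fun v => g v.1) ⟨fun v v' hvv' => by
        rcases (Subtype.coe_le_coe.2 hvv').eq_or_lt with h | h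
        · exact (congrArg g h).le
        · obtain ⟨q, -, hi, hle, -⟩ := ih v'.1 v'.2
          exact (hi _ h).trans hle, fun i => by
        obtain ⟨q, hq, -, hle, -⟩ := ih i.1 i.2
        exact hq.trans hle⟩
      rw [← hg] at hle hR
      exact ⟨q, hq, fun v hv => hi ⟨v, hv⟩, hle, hR⟩
  refine ⟨g, fun v v' hvv' => ?_, fun w => ?_, key⟩
  · rcases hvv'.eq_or_lt with h | h
    · rw [h]
    · obtain ⟨q, -, hi, hle, -⟩ := key v'
      exact (hi _ h).trans hle
  · obtain ⟨q, hq, -, hle, -⟩ := key w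
    exact hq.trans hle

/-- A model of the class whose underlying set is a subset of `X` of cardinality at most `κ`. -/
structure ModelIn (K : InductiveAmalgamationClass.{u} L) (X : Type u) (κ : Cardinal.{u}) where
  /-- The underlying set. -/
  carrier : Set X
  /-- The structure on the underlying set. -/
  str : L.Structure carrier
  isModel : K.IsModel carrier
  card_le : #carrier ≤ κ

namespace ModelIn

variable {K : InductiveAmalgamationClass.{u} L} {X : Type u} {κ : Cardinal.{u}}

instance (p : ModelIn K X κ) : L.Structure p.carrier := p.str

/-- The inclusion of a subset as a map. -/
def incl {s t : Set X} (h : s ⊆ t) : s ≃. t := ofInj (Set.inclusion h) (Set.inclusion_injective h)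

theorem mem_incl {s t : Set X} {h : s ⊆ t} {a : s} {b : t} : b ∈ incl h a ↔ a.1 = b.1 := by
  rw [incl, mem_ofInj, Subtype.ext_iff]

theorem isTotal_incl {s t : Set X} (h : s ⊆ t) : IsTotal (incl h) := isTotal_ofInj _ _

theorem incl_trans {s t r : Set X} (h : s ⊆ t) (h' : t ⊆ r) :
    (incl h).trans (incl h') = incl (h.trans h') :=
  pequiv_ext_mem fun a b => by
    rw [PEquiv.mem_trans, mem_incl]
    constructor
    · rintro ⟨c, hc, hb⟩
      rw [mem_incl] at hc hb
      exact hc.trans hb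
    · exact fun hb => ⟨⟨a.1, h a.2⟩, mem_incl.2 rfl, mem_incl.2 hb⟩

instance : Preorder (ModelIn K X κ) where
  le p q := ∃ h : p.carrier ⊆ q.carrier, K.IsMor (incl h)
  le_refl p := ⟨subset_rfl, by
    convert! K.id_mor p.isModel using 1
    exact pequiv_ext_mem fun a b => by
      rw [mem_incl, PEquiv.refl_apply, Option.mem_some_iff, Subtype.ext_iff]⟩
  le_trans p q r := fun ⟨h, hm⟩ ⟨h', hm'⟩ => ⟨h.trans h', by
    rw [← incl_trans h h']
    exact K.comp_mor hm hm'⟩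

theorem funMap_inclusion {p q : ModelIn K X κ} (h : p ≤ q) {n : ℕ} (F : L.Functions n)
    (x : Fin n → p.carrier) :
    Set.inclusion h.1 (Structure.funMap F x) = Structure.funMap F (Set.inclusion h.1 ∘ x) := by
  obtain ⟨hs, hm⟩ := h
  obtain ⟨g, hg⟩ := (K.partialEmbedding hm).exists_embedding (isTotal_incl hs)
  have : ⇑g = Set.inclusion hs := funext fun a => by
    have : Set.inclusion hs a ∈ embMap g a := hg ▸ mem_incl.2 rfl
    exact mem_embMap.1 this
  rw [← this, g.map_fun]

theorem relMap_inclusion {p q : ModelIn K X κ} (h : p ≤ q) {n : ℕ} (R : L.Relations n)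
    (x : Fin n → p.carrier) :
    Structure.RelMap R (Set.inclusion h.1 ∘ x) ↔ Structure.RelMap R x := by
  obtain ⟨hs, hm⟩ := h
  obtain ⟨g, hg⟩ := (K.partialEmbedding hm).exists_embedding (isTotal_incl hs)
  have : ⇑g = Set.inclusion hs := funext fun a => by
    have : Set.inclusion hs a ∈ embMap g a := hg ▸ mem_incl.2 rfl
    exact mem_embMap.1 this
  rw [← this, g.map_rel]

/-- The union of a well-ordered chain. -/
theorem exists_iUnion (hκ : ℵ₀ ≤ κ) {W : Type u} [LinearOrder W] [WellFoundedLT W] [Nonempty W]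
    (hW : #W ≤ κ) (g : W → ModelIn K X κ) (hg : Monotone g) :
    ∃ q : ModelIn K X κ, (∀ w, g w ≤ q) ∧ q.carrier = ⋃ w, (g w).carrier := by
  let s : Set X := ⋃ w, (g w).carrier
  have hsub : ∀ w, (g w).carrier ⊆ s := fun w => Set.subset_iUnion (fun w => (g w).carrier) w
  have hfin : ∀ {n : ℕ} (x : Fin n → s), ∃ w, ∀ i, (x i).1 ∈ (g w).carrier := fun {n} x => by
    choose w hw using fun i => Set.mem_iUnion.1 (x i).2
    obtain ⟨m, hm⟩ := Finite.exists_le w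
    exact ⟨m, fun i => (hg (hm i)).1 (hw i)⟩
  choose idx hidx using @hfin
  -- Symbols are evaluated at a chosen stage containing the finite tuple; `hfun` and `hrel` show
  -- that the stage does not matter.
  let str : L.Structure s :=
    ⟨fun {n} F x => ⟨(Structure.funMap F fun i => (⟨(x i).1, hidx x i⟩ : (g (idx x)).carrier)).1,
        hsub _ (Subtype.prop _)⟩,
      fun {n} R x => Structure.RelMap R fun i => (⟨(x i).1, hidx x i⟩ : (g (idx x)).carrier)⟩
  have hfun : ∀ (w : W) {n : ℕ} (F : L.Functions n) (x : Fin n → (g w).carrier),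
      Set.inclusion (hsub w) (Structure.funMap F x) =
        Structure.funMap F (Set.inclusion (hsub w) ∘ x) := fun w n F x => by
    refine Subtype.ext ?_
    change (Structure.funMap F x).1 = (Structure.funMap F fun i =>
      (⟨(x i).1, hidx (Set.inclusion (hsub w) ∘ x) i⟩ :
        (g (idx (Set.inclusion (hsub w) ∘ x))).carrier)).1
    rcases le_total w (idx (Set.inclusion (hsub w) ∘ x)) with h | h
    · exact congrArg Subtype.val (funMap_inclusion (hg h) F x)
    · exact (congrArg Subtype.val (funMap_inclusion (hg h) F fun i =>
        (⟨(x i).1, hidx (Set.inclusion (hsub w) ∘ x) i⟩ :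
          (g (idx (Set.inclusion (hsub w) ∘ x))).carrier))).symm
  have hrel : ∀ (w : W) {n : ℕ} (R : L.Relations n) (x : Fin n → (g w).carrier),
      Structure.RelMap R (Set.inclusion (hsub w) ∘ x) ↔ Structure.RelMap R x := fun w n R x => by
    change (Structure.RelMap R fun i =>
      (⟨(x i).1, hidx (Set.inclusion (hsub w) ∘ x) i⟩ :
        (g (idx (Set.inclusion (hsub w) ∘ x))).carrier)) ↔ _
    rcases le_total w (idx (Set.inclusion (hsub w) ∘ x)) with h | h
    · exact relMap_inclusion (hg h) R x
    · exact (relMap_inclusion (hg h) R fun i =>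
        (⟨(x i).1, hidx (Set.inclusion (hsub w) ∘ x) i⟩ :
          (g (idx (Set.inclusion (hsub w) ∘ x))).carrier)).symm
  let emb : ∀ w, (g w).carrier ↪[L] s := fun w =>
    ⟨⟨Set.inclusion (hsub w), Set.inclusion_injective _⟩, fun F x => hfun w F x,
      fun R x => hrel w R x⟩
  -- Axiom (In) speaks of substructures of the union, so each stage is replaced by its isomorphic
  -- image.
  let S : W → L.Substructure s := fun w => (emb w).toHom.range
  have hmemS : ∀ w (x : s), x ∈ S w ↔ x.1 ∈ (g w).carrier := fun w x => by
    constructor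
    · rintro ⟨y, rfl⟩
      exact y.2
    · exact fun h => ⟨⟨x.1, h⟩, rfl⟩
  have hS : Monotone S := fun v w h x hx => (hmemS w x).2 ((hg h).1 ((hmemS v x).1 hx))
  let e : ∀ w, (g w).carrier ≃[L] S w := fun w => (emb w).equivRange
  have he : ∀ w a, ((e w a : s) : X) = a := fun w a => rfl
  have hmodS : ∀ w, K.IsModel (S w) := fun w =>
    InductiveAmalgamationClass.isModel_of_elementaryEmbedding (g w).isModel
      (e w).symm.toElementaryEmbedding
  have hmor : ∀ w, K.IsMor (ofInj (e w) (e w).injective) := fun w =>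
    InductiveAmalgamationClass.isMor_ofInj_equiv (hmodS w) (e w)
  have hlim := K.ind S hS hmodS (fun v w h => by
    refine K.restr (K.comp_mor (K.comp_mor (K.k2 (hmor v)) (hg h.le).2) (hmor w))
      (PEquiv.le_def.2 fun x y hxy => ?_)
    rw [mem_embMap] at hxy
    have hx := (hmemS v x.1).1 x.2
    refine (PEquiv.mem_trans ..).2 ⟨⟨x.1.1, (hg h.le).1 hx⟩, (PEquiv.mem_trans ..).2
      ⟨⟨x.1.1, hx⟩, (PEquiv.mem_iff_mem _).2 (mem_ofInj.2 ?_), mem_incl.2 rfl⟩, mem_ofInj.2 ?_⟩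
    · rfl
    · subst hxy
      rfl) (fun x => by
    obtain ⟨w, hw⟩ := Set.mem_iUnion.1 x.2
    exact ⟨w, (hmemS w x).2 hw⟩)
  refine ⟨⟨s, str, hlim.1, ?_⟩, fun w => ⟨hsub w, ?_⟩, rfl⟩
  · refine (mk_iUnion_le _).trans ?_
    refine (mul_le_mul' hW (ciSup_le' fun w => (g w).card_le)).trans ?_
    rw [mul_eq_self hκ]
  · refine K.restr (K.comp_mor (hmor w) (hlim.2 w)) (PEquiv.le_def.2 fun x y hxy => ?_)
    rw [mem_incl] at hxy
    refine (PEquiv.mem_trans ..).2 ⟨e w x, mem_ofInj.2 rfl, mem_embMap.2 (Subtype.ext ?_)⟩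
    exact hxy

end ModelIn

theorem exists_elementarySubstructure_card_le {M : Type u} [L.Structure M] (hL : L.card ≤ ℵ₀)
    (s : Set M) {κ : Cardinal.{u}} (h1 : ℵ₀ ≤ κ) (h2 : #s ≤ κ) :
    ∃ S : L.ElementarySubstructure M, s ⊆ S ∧ #S ≤ κ := by
  rcases le_total κ #M with h | h
  · obtain ⟨S, hS, hc⟩ := exists_elementarySubstructure_card hL s κ h1 h2 h
    exact ⟨S, hS, hc.le⟩
  · exact ⟨⊤, fun _ _ => trivial, (mk_subtype_le _).trans h⟩

/-! ### Counting below an inaccessible cardinal -/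

/-- There are few structures on a small set. -/
theorem mk_structure_lt (hL : L.card ≤ ℵ₀) {κ : Cardinal.{u}} (hκ : κ.IsInaccessible) (a : Type u)
    (ha : #a < κ) : #(L.Structure a) < κ := by
  -- A structure is coded by its diagram: symbol, arguments, and the value as a singleton list, or
  -- the empty list for relations. The codes are subsets of a set of size below `κ`, and `κ` is a
  -- strong limit.
  let code : L.Structure a → Set (L.Symbols × List a × List a) := fun S =>
    {t | (∃ (n : ℕ) (F : L.Functions n) (x : Fin n → a),
        t = (Sum.inl ⟨n, F⟩, List.ofFn x, [S.funMap F x])) ∨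
      ∃ (n : ℕ) (R : L.Relations n) (x : Fin n → a),
        S.RelMap R x ∧ t = (Sum.inr ⟨n, R⟩, List.ofFn x, [])}
  have hfun : ∀ (S : L.Structure a) {n : ℕ} (F : L.Functions n) (x : Fin n → a) (y : a),
      (Sum.inl ⟨n, F⟩, List.ofFn x, [y]) ∈ code S ↔ S.funMap F x = y := fun S n F x y => by
    constructor
    · rintro (⟨m, G, z, h⟩ | ⟨m, G, z, -, h⟩)
      · simp only [Prod.mk.injEq, Sum.inl.injEq, Sigma.mk.injEq] at h
        obtain ⟨⟨rfl, h1⟩, h2, h3⟩ := h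
        obtain rfl := eq_of_heq h1
        obtain rfl := List.ofFn_injective h2
        exact (List.singleton_inj.1 h3).symm
      · simp at h
    · rintro rfl
      exact Or.inl ⟨n, F, x, rfl⟩
  have hrel : ∀ (S : L.Structure a) {n : ℕ} (R : L.Relations n) (x : Fin n → a),
      (Sum.inr ⟨n, R⟩, List.ofFn x, []) ∈ code S ↔ S.RelMap R x := fun S n R x => by
    constructor
    · rintro (⟨m, G, z, h⟩ | ⟨m, G, z, hz, h⟩)
      · simp at h
      · simp only [Prod.mk.injEq, Sum.inr.injEq, Sigma.mk.injEq] at h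
        obtain ⟨⟨rfl, h1⟩, h2, -⟩ := h
        obtain rfl := eq_of_heq h1
        obtain rfl := List.ofFn_injective h2
        exact hz
    · exact fun h => Or.inr ⟨n, R, x, h, rfl⟩
  have hinj : Function.Injective code := fun S S' h => by
    refine Structure.ext ?_ ?_
    · funext n F x
      exact ((hfun S F x _).1 (h ▸ (hfun S' F x _).2 rfl))
    · funext n R x
      exact propext (by rw [← hrel S R x, h, hrel S' R x])
  refine (mk_le_of_injective hinj).trans_lt ?_
  rw [mk_set]
  refine hκ.isStrongPrelimit ?_
  have hlist : #(List a) < κ := (mk_list_le_max a).trans_lt (max_lt hκ.1 ha)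
  simp only [mk_prod, lift_id]
  refine mul_lt_of_lt hκ.1.le (lt_of_le_of_lt ?_ hκ.1) ?_
  · have : lift.{u} #L.Symbols ≤ lift.{u} ℵ₀ := lift_le.2 hL
    simpa using this
  · simpa using mul_lt_of_lt hκ.1.le hlist hlist

theorem mk_small_subsets_le {κ : Cardinal.{u}} (hκ : κ.IsInaccessible) (β : Type u) (hβ : #β ≤ κ) :
    #{s : Set β // #s < κ} ≤ κ := by
  obtain ⟨Λ, rfl⟩ := κ.exists_rep
  change #β ≤ #Λ at hβ
  change #{s : Set β // #s < #Λ} ≤ #Λ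
  obtain ⟨j⟩ := hβ
  have h := mk_subset_mk_lt_cof (α := Λ) hκ.isStrongLimit.isStrongPrelimit
  have hc : (#Λ).ord.cof = #Λ := hκ.isRegular.cof_ord
  rw [hc] at h
  refine le_trans ?_ h.le
  exact mk_le_of_injective (f := fun s : {s : Set β // #s < #Λ} =>
    (⟨j '' s.1, (mk_image_le).trans_lt s.2⟩ : {s : Set Λ // #s < #Λ}))
    fun s t h => Subtype.ext (j.injective.image_injective (Subtype.mk.inj h))

/-- A partial injection is its graph, a subset of `α × β` of size at most `#α < κ`. -/
theorem mk_pequiv_le {κ : Cardinal.{u}} (hκ : κ.IsInaccessible) (α β : Type u) (hα : #α < κ)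
    (hβ : #β ≤ κ) : #(α ≃. β) ≤ κ := by
  have hg : ∀ f : α ≃. β, #{t : α × β | t.2 ∈ f t.1} < κ := fun f =>
    lt_of_le_of_lt (mk_le_of_injective (f := fun t : {t : α × β | t.2 ∈ f t.1} => t.1.1)
      fun s t h => Subtype.ext (Prod.ext h (mem_unique s.2 (by
        have := t.2
        simp only [Set.mem_ofPred_eq] at this
        change s.1.1 = t.1.1 at h
        rwa [← h] at this)))) hα
  refine (mk_le_of_injective (f := fun f : α ≃. β =>
    (⟨{t : α × β | t.2 ∈ f t.1}, hg f⟩ : {s : Set (α × β) // #s < κ})) fun f g h => ?_).trans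
    (mk_small_subsets_le hκ (α × β) ?_)
  · have h := Subtype.mk.inj h
    exact pequiv_ext_mem fun a b => (Set.ext_iff.1 h (a, b))
  · simpa using mul_le_of_le hκ.1.le hα.le hβ

/-! ### Extending many morphisms at once -/

namespace ModelIn

variable {K : InductiveAmalgamationClass.{u} L} {X : Type u} {κ : Cardinal.{u}}

/-- A small model can be copied into `X`, along any extension of a given submodel. -/
theorem exists_equiv (hκ : ℵ₀ ≤ κ) (hX : κ < #X) (p : ModelIn K X κ) {N : Type u} [L.Structure N]
    (hN : #N ≤ κ) {g : p.carrier ≃. N} (hg : K.IsMor g) (ht : IsTotal g) :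
    ∃ q : ModelIn K X κ, p ≤ q ∧ ∃ e : N ≃[L] q.carrier, ∀ a b, b ∈ g a → (e b).1 = a.1 := by
  have : Infinite X := infinite_iff.2 (hκ.trans hX.le)
  obtain ⟨G, hG, rfl⟩ := ht.exists_eq_ofInj
  obtain ⟨k⟩ : Nonempty (N ↪ (p.carrierᶜ : Set X)) := by
    rw [← Cardinal.le_def, mk_compl_of_infinite _ (p.card_le.trans_lt hX)]
    exact hN.trans hX.le
  -- Points of the image of `g` return to their origin in `p`; the others go to fresh points,
  -- available because `p` has size at most `κ < #X`.
  let j : N → X := Function.extend G Subtype.val fun b => (k b).1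
  have hjG : ∀ a, j (G a) = a.1 := fun a => hG.extend_apply _ _ a
  have hjk : ∀ b, (¬ ∃ a, G a = b) → j b = (k b).1 := fun b h => Function.extend_apply' _ _ _ h
  have hj : Function.Injective j := fun b b' h => by
    by_cases hb : ∃ a, G a = b <;> by_cases hb' : ∃ a, G a = b'
    · obtain ⟨a, rfl⟩ := hb
      obtain ⟨a', rfl⟩ := hb'
      rw [hjG, hjG] at h
      rw [Subtype.ext h]
    · obtain ⟨a, rfl⟩ := hb
      rw [hjG, hjk _ hb'] at h
      exact ((k b').2 (h ▸ a.2)).elim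
    · obtain ⟨a, rfl⟩ := hb'
      rw [hjG, hjk _ hb] at h
      exact ((k b).2 (h.symm ▸ a.2)).elim
    · rw [hjk _ hb, hjk _ hb'] at h
      exact k.injective (Subtype.ext h)
  let str : L.Structure (Set.range j) := (Equiv.ofInjective j hj).inducedStructure
  let e : N ≃[L] Set.range j := (Equiv.ofInjective j hj).inducedStructureEquiv
  have hNm := (K.isModel_of_mor hg).2
  have hq : K.IsModel (Set.range j) :=
    InductiveAmalgamationClass.isModel_of_elementaryEmbedding hNm e.symm.toElementaryEmbedding
  refine ⟨⟨Set.range j, str, hq, mk_range_le.trans hN⟩, ⟨fun x hx => ⟨G ⟨x, hx⟩, hjG _⟩, ?_⟩,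
    e, fun a b hb => ?_⟩
  · refine K.restr (K.comp_mor hg (InductiveAmalgamationClass.isMor_ofInj_equiv hq e))
      (PEquiv.le_def.2 fun x y hxy => ?_)
    refine (PEquiv.mem_trans ..).2 ⟨G x, mem_ofInj.2 rfl, mem_ofInj.2 (Subtype.ext ?_)⟩
    exact (hjG x).trans (mem_incl.1 hxy)
  · rw [mem_ofInj] at hb
    subst hb
    exact hjG a

/-- The map `f` into `p` extends to a total morphism into `q`. -/
def Extends {p : ModelIn K X κ} {A : Type u} [L.Structure A] (f : A ≃. p.carrier)
    (q : ModelIn K X κ) : Prop :=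
  ∃ h : A ≃. q.carrier, K.IsMor h ∧ IsTotal h ∧ ∀ a b b', b ∈ f a → b.1 = b'.1 → b' ∈ h a

/-- The amalgam provided by (Ap) may be large; an elementary submodel of size at most `κ` containing
both images is cut out and copied into `X` over `p`. -/
theorem exists_extends (hL : L.card ≤ ℵ₀) (hκ : ℵ₀ ≤ κ) (hX : κ < #X) (p : ModelIn K X κ)
    {A : Type u} [L.Structure A] (hA : #A ≤ κ) {f : A ≃. p.carrier} (hf : K.IsMor f) :
    ∃ q, p ≤ q ∧ Extends f q := by
  obtain ⟨N, _, g, h, hg, htg, hh, hth, hfg⟩ := K.ap hf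
  have hrange : ∀ {B : Type u} {k : B ≃. N}, IsTotal k → #B ≤ κ → #{y | ∃ x, y ∈ k x} ≤ κ :=
    fun {B k} hk hB => by
      obtain ⟨k', hk', rfl⟩ := hk.exists_eq_ofInj
      refine le_trans ?_ ((mk_range_le (f := k')).trans hB)
      exact mk_le_mk_of_subset fun y ⟨x, hx⟩ => ⟨x, mem_ofInj.1 hx⟩
  obtain ⟨S, hS, hSc⟩ := exists_elementarySubstructure_card_le (L := L) hL
    ({y | ∃ x, y ∈ g x} ∪ {y | ∃ x, y ∈ h x}) hκ
    ((mk_union_le _ _).trans (add_le_of_le hκ (hrange htg p.card_le) (hrange hth hA)))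
  have hi := K.k2 (InductiveAmalgamationClass.isMor_ofInj_elementaryEmbedding
    (K.isModel_of_mor hg).2 S.subtype)
  have hmem : ∀ {B : Type u} {k : B ≃. N} {x : B} {y : S}, y.1 ∈ k x →
      y ∈ k.trans (ofInj S.subtype S.subtype.injective).symm x := fun {B k x y} hy =>
    (PEquiv.mem_trans ..).2 ⟨y.1, hy, (PEquiv.mem_iff_mem _).2 (mem_ofInj.2 rfl)⟩
  obtain ⟨q, hpq, e, he⟩ := p.exists_equiv hκ hX hSc (K.comp_mor hg hi) (fun a => by
    obtain ⟨b, hb⟩ := htg a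
    exact ⟨⟨b, hS (Or.inl ⟨a, hb⟩)⟩, hmem hb⟩)
  refine ⟨q, hpq, _, K.comp_mor (K.comp_mor hh hi)
    (InductiveAmalgamationClass.isMor_ofInj_equiv q.isModel e), ?_, fun a b b' hb hbb' => ?_⟩
  · refine IsTotal.trans (fun a => ?_) (isTotal_ofInj _ _)
    obtain ⟨b, hb⟩ := hth a
    exact ⟨⟨b, hS (Or.inr ⟨a, hb⟩)⟩, hmem hb⟩
  · obtain ⟨y, hy⟩ := htg b
    have hya : y ∈ h a := hfg _ _ ((PEquiv.mem_trans ..).2 ⟨b, hb, hy⟩)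
    refine (PEquiv.mem_trans ..).2 ⟨⟨y, hS (Or.inl ⟨b, hy⟩)⟩, hmem hya, mem_ofInj.2 ?_⟩
    exact Subtype.ext ((he b _ (hmem hy)).trans hbb')

theorem Extends.mono {p q q' : ModelIn K X κ} {A : Type u} [L.Structure A] {f : A ≃. p.carrier}
    (h : Extends f q) (hq : q ≤ q') (hpq : p ≤ q) : Extends f q' := by
  obtain ⟨k, hk, hkt, hfk⟩ := h
  obtain ⟨hs, hm⟩ := hq
  refine ⟨k.trans (incl hs), K.comp_mor hk hm, hkt.trans (isTotal_incl hs), fun a b b' hb hbb' => ?_⟩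
  exact (PEquiv.mem_trans ..).2 ⟨⟨b.1, hpq.1 b.2⟩, hfk a b _ hb rfl, mem_incl.2 hbb'⟩

theorem exists_upper_bound (hκ : ℵ₀ ≤ κ) {W : Type u} [LinearOrder W] [WellFoundedLT W]
    (hW : #W ≤ κ) (p : ModelIn K X κ) (g : W → ModelIn K X κ) (hg : Monotone g)
    (hp : ∀ w, p ≤ g w) : ∃ q, p ≤ q ∧ ∀ w, g w ≤ q := by
  cases isEmpty_or_nonempty W with
  | inl h => exact ⟨p, le_rfl, fun w => h.elim w⟩
  | inr h =>
    obtain ⟨q, hq, -⟩ := exists_iUnion hκ hW g hg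
    exact ⟨q, (hp h.some).trans (hq _), hq⟩

/-- Any small family of small morphisms into `p` can be extended simultaneously. -/
theorem exists_extends_family (hL : L.card ≤ ℵ₀) (hκ : ℵ₀ ≤ κ) (hX : κ < #X) (p : ModelIn K X κ)
    {W : Type u} (hW : #W ≤ κ) (A : W → Type u) [∀ w, L.Structure (A w)] (hA : ∀ w, #(A w) ≤ κ)
    (f : ∀ w, A w ≃. p.carrier) (hf : ∀ w, K.IsMor (f w)) :
    ∃ q, p ≤ q ∧ ∀ w, Extends (f w) q := by
  obtain ⟨_, _, -⟩ := exists_ord_eq_type_lt W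
  obtain ⟨g, hg, hpg, hR⟩ := exists_chain (W := W) p
    (fun w g hg hpg => exists_upper_bound hκ ((mk_set_le _).trans hW) p g hg hpg)
    (fun w _ q' => Extends (f w) q') (fun w q hq => by
      obtain ⟨hs, hm⟩ := hq
      obtain ⟨q', hqq', k, hk, hkt, hfk⟩ := exists_extends hL hκ hX q (hA w) (K.comp_mor (hf w) hm)
      refine ⟨q', hqq', k, hk, hkt, fun a b b' hb hbb' => ?_⟩
      exact hfk a ⟨b.1, hs b.2⟩ b' ((PEquiv.mem_trans ..).2 ⟨b, hb, mem_incl.2 rfl⟩) hbb')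
  obtain ⟨q, hpq, hq⟩ := exists_upper_bound hκ hW p g hg hpg
  refine ⟨q, hpq, fun w => ?_⟩
  obtain ⟨-, -, -, -, h⟩ := hR w
  exact h.mono (hq w) (hpg w)

/-- All small morphisms into `p` can be extended simultaneously. -/
theorem exists_extends_all (hL : L.card ≤ ℵ₀) (hκ : κ.IsInaccessible) (hX : κ < #X)
    (p : ModelIn K X κ) :
    ∃ q, p ≤ q ∧ ∀ (A : Type u) [L.Structure A] (f : A ≃. p.carrier), K.IsMor f → #A < κ →
      Extends f q := by
  -- Up to isomorphism the source lives on a small subset of `κ`, so at most `κ` requests represent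
  -- all morphisms from small models.
  let Req := Σ a : {a : Set κ.out // #a < κ}, (L.Structure a.1) × (a.1 ≃. p.carrier)
  have hReq : #Req ≤ κ := by
    rw [mk_sigma]
    refine (sum_le_sum _ (fun _ => κ) fun a => ?_).trans ?_
    · rw [mk_prod, lift_id, lift_id]
      exact mul_le_of_le hκ.1.le (mk_structure_lt hL hκ _ a.2).le (mk_pequiv_le hκ _ _ a.2 p.card_le)
    · rw [sum_const, lift_id, lift_id]
      exact mul_le_of_le hκ.1.le (mk_small_subsets_le hκ _ (mk_out κ).le) le_rfl
  let W := {w : Req // letI := w.2.1; K.IsMor w.2.2}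
  let _ : ∀ w : W, L.Structure w.1.1.1 := fun w => w.1.2.1
  obtain ⟨q, hpq, hq⟩ := exists_extends_family hL hκ.1.le hX p (W := W)
    ((mk_subtype_le _).trans hReq) (fun w => w.1.1.1) (fun w => w.1.1.2.le) (fun w => w.1.2.2)
    fun w => w.2
  refine ⟨q, hpq, fun A _ f hf hA => ?_⟩
  obtain ⟨j⟩ : Nonempty (A ↪ κ.out) := by
    rw [← Cardinal.le_def, mk_out]
    exact hA.le
  let str : L.Structure (Set.range j) := (Equiv.ofInjective j j.injective).inducedStructure
  let e : A ≃[L] Set.range j := (Equiv.ofInjective j j.injective).inducedStructureEquiv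
  have hm : K.IsModel (Set.range j) :=
    InductiveAmalgamationClass.isModel_of_elementaryEmbedding (K.isModel_of_mor hf).1
      e.symm.toElementaryEmbedding
  have he := InductiveAmalgamationClass.isMor_ofInj_equiv hm e
  obtain ⟨h, hh, hht, hfh⟩ := hq ⟨⟨⟨Set.range j, mk_range_le.trans_lt hA⟩, str,
    (ofInj e e.injective).symm.trans f⟩, K.comp_mor (K.k2 he) hf⟩
  refine ⟨(ofInj e e.injective).trans h, K.comp_mor he hh, (isTotal_ofInj _ _).trans hht,
    fun a b b' hb hbb' => (PEquiv.mem_trans ..).2 ⟨e a, mem_ofInj.2 rfl, ?_⟩⟩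
  exact hfh (e a) b b' ((PEquiv.mem_trans ..).2
    ⟨a, (PEquiv.mem_iff_mem _).2 (mem_ofInj.2 rfl), hb⟩) hbb'

end ModelIn

/-! ### Existence of rich models -/

namespace InductiveAmalgamationClass

variable {K : InductiveAmalgamationClass.{u} L}

variable (K) in
/-- All morphisms from models of cardinality less than `κ` into `U` extend to total ones. -/
def IsRichBelow (κ : Cardinal.{u}) (U : Type u) [L.Structure U] : Prop :=
  K.IsModel U ∧ ∀ (A : Type u) [L.Structure A] (f : A ≃. U), K.IsMor f → #A < κ →
    ∃ h : A ≃. U, K.IsMor h ∧ IsTotal h ∧ f ≤ h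

theorem IsRichBelow.isRichAt {κ μ : Cardinal.{u}} {U : Type u} [L.Structure U]
    (hU : K.IsRichBelow κ U) (h : μ < κ) : K.IsRichAt μ U :=
  ⟨hU.1, fun A _ f hf _ hA => hU.2 A f hf (hA.trans_lt h)⟩

theorem _root_.Cardinal.IsRegular.exists_forall_lt {κ : Cardinal.{u}} (hκ : κ.IsRegular) {A : Type u}
    (hA : #A < κ) (k : A → κ.ord.ToType) : ∃ w, ∀ a, k a < w := by
  by_contra! h
  have hc : IsCofinal (Set.range k) := fun w => by
    obtain ⟨a, ha⟩ := h w
    exact ⟨k a, ⟨a, rfl⟩, ha⟩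
  have h1 := Order.cof_le hc
  rw [Ordinal.cof_toType, hκ.cof_ord] at h1
  exact (h1.trans mk_range_le).not_gt hA

/-- Every model of inaccessible cardinality `κ` embeds into a model of the same cardinality that is
rich with respect to smaller models. -/
theorem exists_isRichBelow (hL : L.card ≤ ℵ₀) {κ : Cardinal.{u}} (hκ : κ.IsInaccessible)
    {M : Type u} [L.Structure M] (hM : K.IsModel M) (hMκ : #M = κ) :
    ∃ (U : Type u) (_ : L.Structure U) (g : M ≃. U), K.IsRichBelow κ U ∧ #U = κ ∧
      K.IsMor g ∧ IsTotal g := by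
  -- The successor of `κ` leaves fresh points outside every model of size at most `κ`.
  let X := (Order.succ κ).out
  have hX : κ < #X := by
    rw [mk_out]
    exact Order.lt_succ κ
  obtain ⟨j⟩ : Nonempty (M ↪ X) := by
    rw [← Cardinal.le_def, hMκ]
    exact hX.le
  let str : L.Structure (Set.range j) := (Equiv.ofInjective j j.injective).inducedStructure
  let e : M ≃[L] Set.range j := (Equiv.ofInjective j j.injective).inducedStructureEquiv
  have hm : K.IsModel (Set.range j) :=
    isModel_of_elementaryEmbedding hM e.symm.toElementaryEmbedding
  let p : ModelIn K X κ := ⟨Set.range j, str, hm, mk_range_le.trans hMκ.le⟩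
  have hW : #κ.ord.ToType ≤ κ := by rw [mk_toType, card_ord]
  have : Nonempty κ.ord.ToType := Ordinal.nonempty_toType_iff.2 (by simpa using hκ.ne_zero)
  obtain ⟨g, hg, hpg, hR⟩ := exists_chain (W := κ.ord.ToType) p
    (fun w g hg hpg => ModelIn.exists_upper_bound hκ.1.le ((mk_set_le _).trans hW) p g hg hpg)
    (fun w q q' => ∀ (A : Type u) [L.Structure A] (f : A ≃. q.carrier), K.IsMor f → #A < κ →
      ModelIn.Extends f q') (fun w q _ => ModelIn.exists_extends_all hL hκ hX q)
  obtain ⟨q, hq, hqc⟩ := ModelIn.exists_iUnion hκ.1.le hW g hg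
  obtain ⟨hpq, hpqm⟩ : p ≤ q := (hpg (Classical.arbitrary _)).trans (hq _)
  refine ⟨q.carrier, q.str, (ofInj e e.injective).trans (ModelIn.incl hpq), ⟨q.isModel, ?_⟩, ?_,
    K.comp_mor (isMor_ofInj_equiv hm e) hpqm,
    (isTotal_ofInj _ _).trans (ModelIn.isTotal_incl _)⟩
  · intro A _ f hf hA
    have hidx : ∀ a : A, ∃ w, ∀ b, b ∈ f a → b.1 ∈ (g w).carrier := fun a => by
      by_cases h : ∃ b, b ∈ f a
      · obtain ⟨b, hb⟩ := h
        obtain ⟨w, hw⟩ := Set.mem_iUnion.1 (hqc.subset b.2)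
        exact ⟨w, fun b' hb' => mem_unique hb hb' ▸ hw⟩
      · exact ⟨Classical.arbitrary _, fun b hb => (h ⟨b, hb⟩).elim⟩
    choose k hk using hidx
    -- By regularity the image of `f` appears before some stage `w`, so `f` factors through the
    -- bound `r` of the stages below `w`, and step `w` extends it.
    obtain ⟨w, hw⟩ := hκ.isRegular.exists_forall_lt hA k
    obtain ⟨r, -, hr, hrg, hext⟩ := hR w
    obtain ⟨hrq, hrqm⟩ := hrg.trans (hq w)
    obtain ⟨hgq, hgqm⟩ := hq w
    obtain ⟨h, hh, hht, hfh⟩ := hext A (f.trans (ModelIn.incl hrq).symm)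
      (K.comp_mor hf (K.k2 hrqm)) hA
    refine ⟨h.trans (ModelIn.incl hgq), K.comp_mor hh hgqm, hht.trans (ModelIn.isTotal_incl _),
      PEquiv.le_def.2 fun a b hb => ?_⟩
    have hbr : b.1 ∈ r.carrier := (hr _ (hw a)).1 (hk a b hb)
    refine (PEquiv.mem_trans ..).2 ⟨⟨b.1, hrg.1 hbr⟩, ?_, ModelIn.mem_incl.2 rfl⟩
    exact hfh a ⟨b.1, hbr⟩ _ ((PEquiv.mem_trans ..).2
      ⟨b, hb, (PEquiv.mem_iff_mem _).2 (ModelIn.mem_incl.2 rfl)⟩) rfl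
  · refine le_antisymm q.card_le ?_
    exact (hMκ.symm.trans (mk_range_eq j j.injective).symm).le.trans (mk_le_mk_of_subset hpq)

/-- Every model of inaccessible cardinality embeds into a rich model of the same cardinality. -/
theorem exists_isRich (hL : L.card ≤ ℵ₀) {κ : Cardinal.{u}} (hκ : κ.IsInaccessible)
    {M : Type u} [L.Structure M] (hM : K.IsModel M) (hMκ : #M = κ) :
    ∃ (U : Type u) (_ : L.Structure U) (g : M ≃. U), K.IsRich U ∧ K.IsMor g ∧ IsTotal g := by
  obtain ⟨U, _, g, hU, hUκ, hg, hgt⟩ := exists_isRichBelow hL hκ hM hMκ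
  refine ⟨U, _, g, ⟨hU.1, fun A _ f hf hfA hA => ?_⟩, hg, hgt⟩
  rw [hUκ] at hA
  rcases hA.lt_or_eq with hA | hA
  · exact hU.2 A f hf hA
  -- A source of size `κ` is enclosed in a model `B` rich below `κ`. Morphisms from `B` to `U` are
  -- then elementary, and elementary maps, unlike general morphisms, are preserved by unions of
  -- chains.
  obtain ⟨B, _, i, hB, hBκ, hi, hit⟩ := exists_isRichBelow hL hκ (K.isModel_of_mor hf).1 hA
  have hel : ∀ {f : B ≃. U}, K.IsMor f → IsElementaryMap L f := fun hf =>
    (hB.isRichAt hκ.1).isElementaryMap hL (hU.isRichAt hκ.1) hf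
  obtain ⟨h, hh, hht, hle⟩ := exists_total_isElementaryMap hκ.1.le hBκ.le (fun k hk hkκ b => by
    -- Richness at this cardinal, still below `κ`, is what extending `k` by one point needs.
    have hlt : max ℵ₀ (Order.succ (mapCard k)) < κ :=
      max_lt hκ.1 (hκ.isSuccLimit.succ_lt hkκ)
    obtain ⟨k', hk', hle, hb⟩ := (hU.isRichAt hlt).exists_extend hL (K.k1 hB.1 hU.1 hk)
      (le_max_left _ _) le_rfl (hBκ ▸ hlt.le)
      ((Order.lt_succ _).trans_le (le_max_right _ _)) b
    exact ⟨k', hel hk', hle, hb⟩) (hel (K.comp_mor (K.k2 hi) hf))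
    ((mapCard_trans_le _ _).trans_lt (hA ▸ hfA))
  refine ⟨i.trans h, K.comp_mor hi (K.k1 hB.1 hU.1 hh), hit.trans hht,
    PEquiv.le_def.2 fun a b hb => ?_⟩
  obtain ⟨c, hc⟩ := hit a
  exact (PEquiv.mem_trans ..).2 ⟨c, hc, hle _ _ ((PEquiv.mem_trans ..).2
    ⟨a, (PEquiv.mem_iff_mem _).2 hc, hb⟩)⟩

end InductiveAmalgamationClass

/-! ### Compactness and realization of types -/

/-- **Compactness** for sets of formulas. -/
theorem exists_realize_of_finite {U α : Type u} [L.Structure U] [Nonempty U]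
    (G : Set (L.Formula α))
    (h : ∀ G₀ : Finset (L.Formula α), (G₀ : Set _) ⊆ G → ∃ v : α → U, ∀ φ ∈ G₀, φ.Realize v) :
    ∃ (N : Type u) (_ : L.Structure N) (v : α → N), ∀ φ ∈ G, φ.Realize v := by
  classical
  have hsat : Theory.IsSatisfiable (Formula.equivSentence '' G : L[[α]].Theory) := by
    rw [Theory.isSatisfiable_iff_isFinitelySatisfiable]
    intro T₀ hT₀
    obtain ⟨v, hv⟩ := h (T₀.image Formula.equivSentence.symm) (fun φ hφ => by
      obtain ⟨ψ, hψ, rfl⟩ := Finset.mem_image.1 (Finset.mem_coe.1 hφ)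
      obtain ⟨χ, hχ, rfl⟩ := hT₀ hψ
      simpa using hχ)
    let _ : (constantsOn α).Structure U := constantsOn.structure v
    have : U ⊨ (T₀ : L[[α]].Theory) := ⟨fun φ hφ =>
      (Formula.realize_equivSentence_symm U φ v).1 (hv _ (Finset.mem_image_of_mem _ hφ))⟩
    exact Theory.Model.isSatisfiable U
  obtain ⟨N⟩ := hsat
  let _ : L.Structure N := (L.lhomWithConstants α).reduct N
  have : (L.lhomWithConstants α).IsExpansionOn N := LHom.isExpansionOn_reduct _ _
  refine ⟨N, inferInstance, fun a => (L.con a : N), fun φ hφ => ?_⟩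
  rw [← Formula.realize_equivSentence]
  exact N.is_model.realize_of_mem _ ⟨φ, hφ, rfl⟩

/-- A type over a subset of `U` is realized in an elementary extension of the same cardinality. -/
theorem exists_elementaryEmbedding_realize (hL : L.card ≤ ℵ₀) {U : Type u} [L.Structure U]
    [Infinite U] (A : Set U) (n : ℕ) (p : Set (L.Formula (A ⊕ Fin n)))
    (hp : ∀ p₀ : Finset (L.Formula (A ⊕ Fin n)), (p₀ : Set _) ⊆ p →
      ∃ x : Fin n → U, ∀ φ ∈ p₀, φ.Realize (Sum.elim (fun a : A => (a : U)) x)) :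
    ∃ (N : Type u) (_ : L.Structure N) (e : U ↪ₑ[L] N) (x : Fin n → N), #N = #U ∧
      ∀ φ ∈ p, φ.Realize (Sum.elim (fun a : A => e a) x) := by
  classical
  -- This is the elementary diagram of `U`; a realization of it together with `p` gives the
  -- elementary extension and the tuple.
  let D : Set (L.Formula (U ⊕ Fin n)) := {ψ | ∃ φ : L.Formula U, φ.Realize id ∧
    φ.relabel Sum.inl = ψ}
  let r : L.Formula (A ⊕ Fin n) → L.Formula (U ⊕ Fin n) :=
    fun φ => φ.relabel (Sum.map Subtype.val id)
  obtain ⟨N, _, v, hv⟩ := exists_realize_of_finite (U := U) (D ∪ r '' p) (fun G₀ hG₀ => by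
    have hpre : ∀ ψ : (r '' p : Set _), ∃ φ ∈ p, r φ = ψ.1 := fun ψ => ψ.2
    choose s hs hrs using hpre
    obtain ⟨x, hx⟩ := hp ((G₀.subtype (· ∈ r '' p)).image s) (fun φ hφ => by
      obtain ⟨ψ, -, rfl⟩ := Finset.mem_image.1 (Finset.mem_coe.1 hφ)
      exact hs ψ)
    refine ⟨Sum.elim id x, fun φ hφ => ?_⟩
    rcases hG₀ hφ with ⟨ψ, hψ, rfl⟩ | h
    · rw [Formula.realize_relabel]
      exact hψ
    · have := hx (s ⟨φ, h⟩) (Finset.mem_image_of_mem _ (Finset.mem_subtype.2 hφ))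
      rw [← show r (s ⟨φ, h⟩) = φ from hrs ⟨φ, h⟩, Formula.realize_relabel]
      convert! this using 1
      ext (a | i) <;> rfl)
  have hcard : #(Set.range v) ≤ #U := by
    refine mk_range_le.trans ?_
    have h₁ : ((n : ℕ) : Cardinal.{u}) ≤ #U := (natCast_lt_aleph0).le.trans (aleph0_le_mk U)
    simpa using add_le_of_le (aleph0_le_mk U) le_rfl h₁
  obtain ⟨S, hS, hSc⟩ := exists_elementarySubstructure_card_le (L := L) hL (Set.range v)
    (aleph0_le_mk U) hcard
  let w : U ⊕ Fin n → S := fun i => ⟨v i, hS ⟨i, rfl⟩⟩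
  have hw : ∀ {β : Type u} (φ : L.Formula β) (k : β → U ⊕ Fin n),
      φ.Realize (w ∘ k) ↔ φ.Realize (v ∘ k) := fun φ k => (S.subtype.map_formula φ (w ∘ k)).symm
  have hD : ∀ φ : L.Formula U, φ.Realize id → φ.Realize (w ∘ Sum.inl) := fun φ hφ => by
    have := hv _ (Or.inl ⟨φ, hφ, rfl⟩)
    rw [Formula.realize_relabel] at this
    exact (hw φ _).2 this
  let e : U ↪ₑ[L] S := ⟨w ∘ Sum.inl, fun k φ x => by
    have key : ∀ φ : L.Formula (Fin k), φ.Realize x → φ.Realize ((w ∘ Sum.inl) ∘ x) :=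
      fun φ hφ => by
        have := hD (φ.relabel x) (by rw [Formula.realize_relabel]; exact hφ)
        rwa [Formula.realize_relabel] at this
    refine ⟨fun h => ?_, key φ⟩
    by_contra h'
    exact Formula.realize_not.1 (key φ.not (Formula.realize_not.2 h')) h⟩
  refine ⟨S, inferInstance, e, w ∘ Sum.inr, hSc.antisymm (mk_le_of_injective e.injective),
    fun φ hφ => ?_⟩
  have := hv _ (Or.inr ⟨φ, hφ, rfl⟩)
  rw [Formula.realize_relabel, ← hw] at this
  convert! this using 1
  ext (a | i) <;> rfl

/-- Saturated structures realize the types of all tuples in elementarily equivalent structures. -/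
theorem IsSaturated.exists_realize_iff {M U : Type u} [L.Structure M] [L.Structure U] [Nonempty U]
    (hU : IsSaturated L U) (hUM : U ⊨ L.completeTheory M) {n : ℕ} (a : Fin n → M) :
    ∃ x : Fin n → U, ∀ φ : L.Formula (Fin n), φ.Realize x ↔ φ.Realize a := by
  obtain ⟨x, hx⟩ := hU ∅ (by simp [pos_iff_ne_zero, mk_ne_zero]) n
    {ψ | ∃ φ : L.Formula (Fin n), φ.Realize a ∧ φ.relabel Sum.inr = ψ} (fun p₀ hp₀ => by
      choose s hs hrs using fun ψ : p₀ => hp₀ ψ.2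
      let χ : L.Formula (Fin n) := Formula.iInf s
      -- Finite satisfiability transfers from `M` to `U` through one sentence: the existential
      -- closure of the conjunction.
      let σ : L.Sentence := (χ.relabel (Sum.inr : Fin n → Empty ⊕ Fin n)).iExs (Fin n)
      have hσ : ∀ (N : Type u) [L.Structure N], N ⊨ σ ↔ ∃ x : Fin n → N, ∀ i, (s i).Realize x := by
        intro N _
        simp only [Sentence.Realize, σ, χ, Formula.realize_iExs, Formula.realize_relabel,
          Sum.elim_comp_inr, Formula.realize_iInf]
      have hM : M ⊨ σ := (hσ M).2 ⟨a, hs⟩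
      obtain ⟨x, hx⟩ := (hσ U).1 (hUM.realize_of_mem σ hM)
      refine ⟨x, fun ψ hψ => ?_⟩
      rw [← show (s ⟨ψ, hψ⟩).relabel Sum.inr = ψ from hrs ⟨ψ, hψ⟩, Formula.realize_relabel,
        Sum.elim_comp_inr]
      exact hx _)
  have key : ∀ φ : L.Formula (Fin n), φ.Realize a → φ.Realize x := fun φ hφ => by
    have := hx _ ⟨φ, hφ, rfl⟩
    rwa [Formula.realize_relabel, Sum.elim_comp_inr] at this
  refine ⟨x, fun φ => ⟨fun h => ?_, key φ⟩⟩
  by_contra h'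
  exact Formula.realize_not.1 (key φ.not (Formula.realize_not.2 h')) h

/-! ### The equivalence -/

namespace InductiveAmalgamationClass

variable {K : InductiveAmalgamationClass.{u} L}

theorem IsRich.models_richTheory {U : Type u} [L.Structure U] (hU : K.IsRich U) :
    U ⊨ K.richTheory := ⟨fun _ hφ => hφ U hU⟩

theorem ModelCompleteIn.realize_embedding {T : L.Theory} (h : K.ModelCompleteIn T) {M N : Type u}
    [L.Structure M] [L.Structure N] (hM : K.IsModel M) (hN : K.IsModel N) (hMT : M ⊨ T)
    (hNT : N ⊨ T) (g : M ↪[L] N) {α : Type*} (φ : L.Formula α) (v : α → M) :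
    φ.Realize (g ∘ v) ↔ φ.Realize v := by
  let S := g.toHom.range
  let e : M ≃[L] S := g.equivRange
  have hee := e.toElementaryEmbedding.elementarilyEquivalent
  have hS := h N S (K.k0 hM hee) hN (hee.theory_model_iff.1 hMT) hNT
  have h₁ := ElementaryEmbedding.map_formula (ElementarySubstructure.subtype ⟨S, hS⟩) φ (e ∘ v)
  exact h₁.trans (e.toElementaryEmbedding.map_formula φ v)

/-- An elementary extension realizing the type is mapped back into `U` over the parameters by
richness; model-completeness makes the map preserve the type. -/
theorem ModelCompleteIn.richSaturated (hL : L.card ≤ ℵ₀) (h : K.ModelCompleteIn K.richTheory) :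
    K.RichSaturated := by
  intro U _ hU A hA n p hp
  have := K.infinite hU.1
  obtain ⟨N, _, e, x, hN, hx⟩ := exists_elementaryEmbedding_realize hL A n p hp
  have hUN := e.elementarilyEquivalent
  have hNm := K.k0 hU.1 hUN
  -- The inverse of `e` on the parameters is a morphism into `U` of size below `#U`, to which
  -- richness applies.
  let f := restrictMap (ofInj e e.injective) A
  have hf : K.IsMor f.symm := K.k1 hNm hU.1
    ((isElementaryMap_ofInj e).mono (restrictMap_le _ _)).symm
  obtain ⟨k, hk, hkt, hfk⟩ := hU.2 N f.symm hf
    (by rw [mapCard_symm, hN]; exact (mapCard_restrictMap_le _ _).trans_lt hA) hN.le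
  obtain ⟨g, rfl⟩ := (K.partialEmbedding hk).exists_embedding hkt
  have hge : ∀ a ∈ A, g (e a) = a := fun a ha => mem_embMap.1
    (hfk _ _ ((PEquiv.mem_iff_mem _).2 (mem_restrictMap.2 ⟨ha, mem_ofInj.2 rfl⟩)))
  refine ⟨g ∘ x, fun φ hφ => ?_⟩
  have hr := (h.realize_embedding hNm hU.1 (hUN.theory_model_iff.1 hU.models_richTheory)
    hU.models_richTheory g φ _).2 (hx φ hφ)
  convert! hr using 1
  ext (a | i)
  · exact (hge a a.2).symm
  · rfl

/-- With the next lemma, the hypothesis in fullness amounts to `M ⊨ T_rich`: a failing sentence of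
`T_rich` would have its negation true in some rich model. -/
theorem models_richTheory_of_forall {M : Type u} [L.Structure M]
    (h : ∀ φ : L.Sentence, M ⊨ φ → ∃ (U : Type u) (_ : L.Structure U), K.IsRich U ∧ U ⊨ φ) :
    M ⊨ K.richTheory := ⟨fun φ hφ => by
  by_contra hn
  obtain ⟨U, _, hU, hUφ⟩ := h φ.not ((Sentence.realize_not M).2 hn)
  exact (Sentence.realize_not U).1 hUφ (hφ U hU)⟩

theorem exists_isRich_of_models_richTheory {M : Type u} [L.Structure M] (h : M ⊨ K.richTheory)
    (φ : L.Sentence) (hφ : M ⊨ φ) : ∃ (U : Type u) (_ : L.Structure U), K.IsRich U ∧ U ⊨ φ := by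
  by_contra! hn
  exact (Sentence.realize_not M).1 (h.realize_of_mem φ.not fun U _ hU =>
    (Sentence.realize_not U).2 (hn U _ hU)) hφ

/-- Passing to an elementarily equivalent model of size `κ` permits an embedding in a rich model,
and model-completeness transfers the complete theory along it. -/
theorem ModelCompleteIn.isFull (hL : L.card ≤ ℵ₀) {κ : Cardinal.{u}} (hκ : κ.IsInaccessible)
    (h : K.ModelCompleteIn K.richTheory) : K.IsFull := by
  intro M _ hM hφ
  have := K.infinite hM
  obtain ⟨N, hMN, hN⟩ := exists_elementarilyEquivalent_card_eq L M κ hκ.1.le (by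
    have : lift.{u} L.card ≤ lift.{u} ℵ₀ := lift_le.2 hL
    simpa using this.trans (by simpa using hκ.1.le))
  have hNm := K.k0 hM hMN
  obtain ⟨U, _, g, hU, hg, hgt⟩ := exists_isRich hL hκ hNm hN
  obtain ⟨g, rfl⟩ := (K.partialEmbedding hg).exists_embedding hgt
  refine ⟨U, _, hU, ⟨fun φ hMφ => ?_⟩⟩
  have hNφ : N ⊨ φ := (elementarilyEquivalent_iff.1 hMN φ).1 hMφ
  have hr := (h.realize_embedding hNm hU.1
    (hMN.theory_model_iff.1 (models_richTheory_of_forall hφ)) hU.models_richTheory g φ default).2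
    hNφ
  rwa [Subsingleton.elim (g ∘ default) default] at hr

theorem modelCompleteIn_of_richSaturated (hL : L.card ≤ ℵ₀) (hK : K.SubstructuresStrong)
    (hsat : K.RichSaturated) (hfull : K.IsFull) : K.ModelCompleteIn K.richTheory := by
  intro N _ S hS hN hST hNT n φ a
  obtain ⟨U, _, hU, hUS⟩ := hfull S hS (exists_isRich_of_models_richTheory hST)
  obtain ⟨V, _, hV, hVN⟩ := hfull N hN (exists_isRich_of_models_richTheory hNT)
  have := K.infinite hU.1
  have := K.infinite hV.1
  obtain ⟨x, hx⟩ := (hsat U hU).exists_realize_iff hUS a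
  obtain ⟨y, hy⟩ := (hsat V hV).exists_realize_iff hVN (Subtype.val ∘ a)
  have hf := K.k1 hU.1 hS (isElementaryMap_tupleMap hx (eq_iff_of_formula_iff hx))
  have hg := K.k2 (K.k1 hV.1 hN (isElementaryMap_tupleMap hy (eq_iff_of_formula_iff hy)))
  -- The composite `x ↦ a ↦ a ↦ y`, with (#) supplying the middle inclusion as a morphism.
  have hm := K.comp_mor (K.comp_mor hf (hK N S hS hN hST hNT)) hg
  have hel := hU.isRichAt_aleph0.isElementaryMap hL hV.isRichAt_aleph0 hm n φ x y fun i =>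
    (PEquiv.mem_trans ..).2 ⟨(a i).1, (PEquiv.mem_trans ..).2
      ⟨a i, mem_tupleMap.2 ⟨i, rfl, rfl⟩, mem_embMap.2 rfl⟩,
      (PEquiv.mem_iff_mem _).2 (mem_tupleMap.2 ⟨i, rfl, rfl⟩)⟩
  exact (hy φ).symm.trans (hel.symm.trans (hx φ))

theorem modelCompleteIn_iff (hL : L.card ≤ ℵ₀) {κ : Cardinal.{u}} (hκ : κ.IsInaccessible)
    (hK : K.SubstructuresStrong) :
    K.ModelCompleteIn K.richTheory ↔ K.RichSaturated ∧ K.IsFull :=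
  ⟨fun h => ⟨h.richSaturated hL, h.isFull hL hκ⟩,
    fun h => modelCompleteIn_of_richSaturated hL hK h.1 h.2⟩

end InductiveAmalgamationClass

end RichModels

end

theorem theorem5p1 {L : FirstOrder.Language.{0, 0}} (hL : L.card ≤ Cardinal.aleph0)
    (hinacc : ∃ κ : Cardinal.{u}, κ.IsInaccessible)
    (K : RichModels.InductiveAmalgamationClass.{u} L) (hK : K.SubstructuresStrong) :
    (K.ModelCompleteIn K.richTheory ↔ K.RichSaturated ∧ K.IsFull) ∧
    (RichModels.ModelComplete.{u} K.richTheory → K.RichSaturated ∧ K.IsFull) ∧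
    ((∀ (M : Type u) [L.Structure M], M ⊨ K.richTheory → K.IsModel M) →
      (RichModels.ModelComplete.{u} K.richTheory ↔ K.RichSaturated ∧ K.IsFull)) := by
  obtain ⟨κ, hκ⟩ := hinacc
  have hiff := RichModels.InductiveAmalgamationClass.modelCompleteIn_iff hL hκ hK
  have himp : RichModels.ModelComplete.{u} K.richTheory → K.RichSaturated ∧ K.IsFull :=
    fun h => hiff.1 fun N _ S _ _ hS hN => h N S hS hN
  exact ⟨hiff, himp, fun hmod => ⟨himp, fun h N _ S hS hN =>
    hiff.2 h N S (hmod S hS) (hmod N hN) hS hN⟩⟩
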